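/- Conventions. A read once branching program (ROBP) of memory $M$, length $n$ and block size $D$ reads $n$ blocks of $D$ bits in one pass: it starts in a fixed state in $\{0,1\}^M$, updates its state after the $i$-th block by an arbitrary function (depending on $i$) of the current state and the block, and outputs a bit that is a function of the final state. A generator $G:\{0,1\}^S\to(\{0,1\}^D)^n$ fools ROBPs of memory $M$ to error $\delta_2$ if $|\Pr_{u}[P(u)=1]-\Pr_{z}[P(G(z))=1]|\le\delta_2$ for every such program $P$, with $u$ and $z$ uniform. For $K>0$, a real random variable $Y$ is a $\delta$-approximate Gaussian (with constant $K$) if it can be coupled with a standard Gaussian $X$ so that $\Pr(|X-Y|>\delta)<\delta$, and $|Y|\le K\log(1/\delta)$ with probability $1$. For a polynomial $q$ in $n$ variables, $|q|_2=(\mathbb E[q(X)^2])^{1/2}$ with $X$ a standard Gaussian in $\mathbb R^n$. Proposition. For every $K>0$ there are constants $C_1,C_2>0$, depending only on $K$, such that the following holds. Let $n\ge1$ and $d,r,M,S,D\ge 0$ be integers, $0<\delta_1\le 1/2$ and $\delta_2\in\mathbb R$. Let $\varphi_1,\dots,\varphi_n:\{0,1\}^D\to\mathbb R$ be such that each $\varphi_i(u)$,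 $u$ uniform in $\{0,1\}^D$, is a $\delta_1$-approximate Gaussian with constant $K$. Let $G:\{0,1\}^S\to(\{0,1\}^D)^n$ fool ROBPs of memory $M$, length $n$ and block size $D$ to error $\delta_2$, where $M\ge C_1(d+r)\log(n/\delta_1)$, and put $Y=(\varphi_1(G(z)_1),\dots,\varphi_n(G(z)_n))$ with $z$ uniform in $\{0,1\}^S$. Let $X$ be a standard Gaussian in $\mathbb R^n$. Let $s$ be a real polynomial of degree at most $2$ in $n$ variables whose value depends on at most $r$ linear forms (there are linear forms $\ell_1,\dots,\ell_r$ such that $s(x)$ is determined by $\ell_1(x),\dots,\ell_r(x)$), let $I\subseteq\mathbb R$ be an interval (of any kind), let $g$ be the indicator function of $\{x: s(x)\in I\}$, and let $q$ be a real polynomial of degree at most $d$ in $n$ variables. Then $$\bigl|\mathbb E[g(X)q(X)]-\mathbb E[g(Y)q(Y)]\bigr|\le \bigl(C_2\log(1/\delta_1)\bigr)^{d+1}\bigl(\delta_2+n\delta_1^{1/4}\bigr)\,n^d\,|q|_2 .$$ In particular (the case $r=0$), with the same constants, if $M\ge C_1 d\log(n/\delta_1)$ then $$\bigl|\mathbb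 E[q(X)]-\mathbb E[q(Y)]\bigr|\le \bigl(C_2\log(1/\delta_1)\bigr)^{d+1}\bigl(\delta_2+n\delta_1^{1/4}\bigr)\,n^d\,|q|_2 .$$ -/

import Mathlib

open MeasureTheory ProbabilityTheory
open scoped BigOperators

/-- A read once branching program with `M` bits of memory, reading an input of `n` blocks of
`D` bits each in a single pass.  The transition function may depend on the position, and the
Boolean output is a function of the memory contents after the last block. -/
structure ROBP (M D n : ℕ) where
  start : Fin M → Bool
  step : Fin n → (Fin M → Bool) → (Fin D → Bool) → (Fin M → Bool)
  accept : (Fin M → Bool) → Bool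

/-- The Boolean function computed by a read once branching program. -/
def ROBP.compute {M D n : ℕ} (P : ROBP M D n) (x : Fin n → Fin D → Bool) : Bool :=
  P.accept (Fin.foldl n (fun m i => P.step i m (x i)) P.start)

/-- `G : {0,1}^S → ({0,1}^D)^n` fools all read once branching programs of memory `M` (and length
`n`, block size `D`) to within error `ε`. -/
def FoolsROBP (M : ℕ) {S D n : ℕ} (ε : ℝ) (G : (Fin S → Bool) → Fin n → Fin D → Bool) : Prop :=
  ∀ P : ROBP M D n,
    |(𝔼 x : Fin n → Fin D → Bool, (if P.compute x = true then (1 : ℝ) else 0)) -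
      (𝔼 z : Fin S → Bool, (if P.compute (G z) = true then (1 : ℝ) else 0))| ≤ ε

/-- `ν` is the law of a `δ`-approximate Gaussian, where `K` is the constant in the bound
`|Y| = O(log δ)`: there is a coupling `π` of a standard Gaussian (first coordinate) with `ν`
(second coordinate) that is `δ`-close except with probability less than `δ`, and
`|Y| ≤ K log (1/δ)` almost surely. -/
def IsApproxGaussian (K δ : ℝ) (ν : Measure ℝ) : Prop :=
  (∃ π : Measure (ℝ × ℝ), π.fst = gaussianReal 0 1 ∧ π.snd = ν ∧
    π {p | δ < |p.1 - p.2|} < ENNReal.ofReal δ) ∧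
  ∀ᵐ y ∂ν, |y| ≤ K * Real.log (1 / δ)

/-- The law of `φ U` for `U` a uniformly random block of `D` bits. -/
noncomputable def blockLaw {D : ℕ} (φ : (Fin D → Bool) → ℝ) : Measure ℝ :=
  ((PMF.uniformOfFintype (Fin D → Bool)).map φ).toMeasure

/-- The standard Gaussian measure on `ℝⁿ`. -/
noncomputable def stdGauss (n : ℕ) : Measure (Fin n → ℝ) :=
  Measure.pi fun _ => gaussianReal 0 1

/-- The norm `|p|₂ = (E[p(X)²])^{1/2}`, with `X` a standard Gaussian. -/
noncomputable def gaussL2 {n : ℕ} (p : MvPolynomial (Fin n) ℝ) : ℝ :=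
  Real.sqrt (∫ x, (MvPolynomial.eval x p) ^ 2 ∂(stdGauss n))

/-- The value of the polynomial `s` depends on at most `r` linear functions of its argument. -/
def DependsOnLinear {n : ℕ} (r : ℕ) (s : MvPolynomial (Fin n) ℝ) : Prop :=
  ∃ v : Fin r → Fin n → ℝ, ∀ x y : Fin n → ℝ,
    (∀ i, ∑ j, v i j * x j = ∑ j, v i j * y j) → MvPolynomial.eval x s = MvPolynomial.eval y s

/-- The indicator function of the event that `s(x)` lies in `I`. -/
noncomputable def indIn {n : ℕ} (s : MvPolynomial (Fin n) ℝ) (I : Set ℝ) : (Fin n → ℝ) → ℝ :=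
  Set.indicator {x | MvPolynomial.eval x s ∈ I} (fun _ => 1)

/-- The family `Y = (φ₁(Z₁), …, φₙ(Zₙ))` with the blocks `Z = G(z)` produced from the seed `z`. -/
def seededFamily {S D n : ℕ} (φ : Fin n → (Fin D → Bool) → ℝ)
    (G : (Fin S → Bool) → Fin n → Fin D → Bool) (z : Fin S → Bool) : Fin n → ℝ :=
  fun i => φ i (G z i)

/-! ### Normalized Hermite polynomials -/

/-! The bridge between `X` and `Y` is the independent family `φᵢ(uᵢ)` with truly uniform blocks.
Throughout, `q` is expanded in products of normalized Hermite polynomials. By orthonormality each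
coefficient is at most `|q|₂`, and there are at most `(n+1)^d` of them. A normalized Hermite
polynomial of degree `k` is bounded by `(1+|x|)^k`, with no factorial, so a product of total degree
at most `d` costs only a factor of the form `O(log (1/δ₁))^d` on the range of the blocks.

Gaussian against independent blocks (`BlockCoupling.abs_integral_sub_expect_le`): the product of the
given couplings keeps all coordinates within `δ₁`, except with probability at most `nδ₁`. The
polynomial then moves little, and `g` changes only if `s(X)` is close to an endpoint of `I`. After
scaling the largest coefficient of the diagonalized `s` to 1, the scaled value lies within `η` of a
given level with probability at most `10√η`, uniformly in `s` (`gaussianReal_quadratic_le`, extended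
by Fubini and rotation invariance). Since `q(X)` is unbounded, rare events are charged by
Cauchy-Schwarz. The square root of `√η`, with `η` of order `nδ₁ log (1/δ₁)`, is the source of
`δ₁^(1/4)`.

Independent blocks against the generator (`BlockCoupling.abs_expect_hermiteProd_sub_le`): one
Hermite product is treated at a time, because it involves at most `d` coordinates. Together with the
at most `r` orthonormal forms that determine `s`, these can be accumulated in rounded form by a
program with `N^(r+d)` states, `N` polynomial in `n/δ₁`. Fooling all events of the final state means
fooling all bounded functions of it (`exists_fooled_approx_linear_forms`). Rounding matters for `g`
only near an endpoint, and the probability of that event is itself carried over to the generator by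
fooling. -/

theorem integrable_polynomial_gaussianReal (p : Polynomial ℝ) :
    Integrable (fun x => p.eval x) (gaussianReal 0 1) := by
  have hpow : ∀ k : ℕ, Integrable (fun x : ℝ => x ^ k) (gaussianReal 0 1) := by
    intro k
    rcases Nat.eq_zero_or_pos k with rfl | hk
    · simp
    · have h := (memLp_id_gaussianReal (μ := 0) (v := 1) (k : NNReal))
      have h2 : MemLp (id : ℝ → ℝ) (k : ENNReal) (gaussianReal 0 1) := by simpa using h
      have h3 := h2.integrable_norm_pow hk.ne'
      refine h3.mono' (by fun_prop) (ae_of_all _ fun x => ?_)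
      simp
  induction p using Polynomial.induction_on' with
  | add p q hp hq =>
    refine (hp.add hq).congr (ae_of_all _ fun x => ?_)
    simp
  | monomial k a => simpa using (hpow k).const_mul a

theorem integrable_gaussianPDFReal_mul {f : ℝ → ℝ} (hf : Integrable f (gaussianReal 0 1)) :
    Integrable (fun x => gaussianPDFReal 0 1 x * f x) volume := by
  rw [gaussianReal_of_var_ne_zero _ one_ne_zero] at hf
  rw [integrable_withDensity_iff_integrable_smul' (measurable_gaussianPDF 0 1)
    (ae_of_all _ fun x => gaussianPDF_lt_top)] at hf
  simpa [toReal_gaussianPDF] using hf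

theorem hasDerivAt_gaussianPDFReal_std (x : ℝ) :
    HasDerivAt (gaussianPDFReal 0 1) (-x * gaussianPDFReal 0 1 x) x := by
  have h : HasDerivAt (fun x : ℝ => -(x - 0) ^ 2 / (2 * ((1 : NNReal) : ℝ))) (-x) x := by
    have := (((hasDerivAt_id x).sub_const 0).pow 2).neg.div_const (2 * ((1 : NNReal) : ℝ))
    convert! this using 1
    simp
    ring
  have h2 := (h.exp).const_mul ((√(2 * Real.pi * ((1 : NNReal) : ℝ)))⁻¹)
  rw [gaussianPDFReal_def]
  convert! h2 using 1
  simp only [neg_mul]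
  ring

/-- Stein's identity for polynomials. -/
theorem integral_mul_polynomial_gaussianReal (p : Polynomial ℝ) :
    ∫ x, x * p.eval x ∂(gaussianReal 0 1) = ∫ x, p.derivative.eval x ∂(gaussianReal 0 1) := by
  rw [integral_gaussianReal_eq_integral_smul one_ne_zero,
    integral_gaussianReal_eq_integral_smul one_ne_zero]
  have h1 := integrable_gaussianPDFReal_mul (integrable_polynomial_gaussianReal p)
  have h2 := integrable_gaussianPDFReal_mul (integrable_polynomial_gaussianReal p.derivative)
  have h3 := integrable_gaussianPDFReal_mul (integrable_polynomial_gaussianReal (Polynomial.X * p))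
  -- Integration by parts against the density, whose derivative is `-x` times itself.
  have := integral_mul_deriv_eq_deriv_mul_of_integrable (u := fun x => p.eval x)
    (u' := fun x => p.derivative.eval x) (v := gaussianPDFReal 0 1)
    (v' := fun x => -x * gaussianPDFReal 0 1 x)
    (fun x _ => p.hasDerivAt x) (fun x _ => hasDerivAt_gaussianPDFReal_std x)
    (by
      refine h3.neg.congr (ae_of_all _ fun x => ?_)
      simp; ring)
    (by
      refine h2.congr (ae_of_all _ fun x => ?_)
      simp; ring)
    (by
      refine h1.congr (ae_of_all _ fun x => ?_)
      simp; ring)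
  simp only [smul_eq_mul]
  have e1 : ∫ x, gaussianPDFReal 0 1 x * (x * p.eval x) =
      - ∫ x, p.eval x * (-x * gaussianPDFReal 0 1 x) := by
    rw [← integral_neg]; congr 1; ext x; ring
  rw [e1, this, neg_neg]
  congr 1; ext x; ring

/-- The probabilists' Hermite polynomial with real coefficients. -/
noncomputable def realHermite (k : ℕ) : Polynomial ℝ :=
  (Polynomial.hermite k).map (Int.castRingHom ℝ)

theorem realHermite_succ (k : ℕ) :
    realHermite (k + 1) = Polynomial.X * realHermite k - (realHermite k).derivative := by
  simp [realHermite, Polynomial.hermite_succ]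

theorem realHermite_zero : realHermite 0 = 1 := by simp [realHermite]

theorem realHermite_monic (k : ℕ) : (realHermite k).Monic :=
  (Polynomial.hermite_monic k).map _

theorem realHermite_natDegree (k : ℕ) : (realHermite k).natDegree = k := by
  rw [realHermite, (Polynomial.hermite_monic k).natDegree_map, Polynomial.natDegree_hermite]

theorem derivative_realHermite (k : ℕ) :
    (realHermite (k + 1)).derivative = ((k : Polynomial ℝ) + 1) * realHermite k := by
  induction k with
  | zero => simp [realHermite]
  | succ k ih =>
    rw [realHermite_succ (k + 1), Polynomial.derivative_sub, Polynomial.derivative_mul, ih,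
      Polynomial.derivative_mul]
    have h := realHermite_succ k
    have h1 : Polynomial.derivative ((k : Polynomial ℝ) + 1) = 0 := by simp
    rw [h1, zero_mul, zero_add, Polynomial.derivative_X, one_mul, h]
    push_cast
    ring

theorem realHermite_succ_succ (k : ℕ) :
    realHermite (k + 2) = Polynomial.X * realHermite (k + 1) - ((k : Polynomial ℝ) + 1) * realHermite k := by
  rw [realHermite_succ (k + 1), derivative_realHermite]

/-- Stein's identity makes `p ↦ X * p - p'` the adjoint of differentiation, and `realHermite k` is
the `k`-th iterate of this operator at 1. -/
theorem integral_realHermite_mul (k : ℕ) (p : Polynomial ℝ) :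
    ∫ x, (realHermite k * p).eval x ∂(gaussianReal 0 1) =
      ∫ x, (Polynomial.derivative^[k] p).eval x ∂(gaussianReal 0 1) := by
  induction k generalizing p with
  | zero => simp [realHermite_zero]
  | succ k ih =>
    have e : ∀ x, (realHermite (k + 1) * p).eval x =
        x * (realHermite k * p).eval x - ((realHermite k).derivative * p).eval x := by
      intro x; rw [realHermite_succ]; simp; ring
    simp_rw [e]
    rw [integral_sub ?_ (integrable_polynomial_gaussianReal _), integral_mul_polynomial_gaussianReal,
      ← integral_sub (integrable_polynomial_gaussianReal _) (integrable_polynomial_gaussianReal _),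
      Function.iterate_succ_apply, ← ih]
    · congr 1; ext x; simp
    · refine (integrable_polynomial_gaussianReal (Polynomial.X * (realHermite k * p))).congr
        (ae_of_all _ fun x => ?_)
      simp

/-- For `k ≤ j`, all `j` derivatives are moved onto the polynomial of degree `k`: they kill it if `k
< j`, and leave `k!` if `k = j` because it is monic. -/
theorem integral_realHermite_mul_realHermite (j k : ℕ) :
    ∫ x, (realHermite j * realHermite k).eval x ∂(gaussianReal 0 1) =
      if j = k then (k.factorial : ℝ) else 0 := by
  wlog h : k ≤ j generalizing j k
  · rw [mul_comm, this k j (by omega)]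
    by_cases hjk : j = k
    · simp [hjk]
    · simp [hjk, Ne.symm hjk]
  rw [integral_realHermite_mul]
  rcases h.lt_or_eq with h | rfl
  · rw [Polynomial.iterate_derivative_eq_zero (by rwa [realHermite_natDegree])]
    simp [h.ne']
  · have h0 : (Polynomial.derivative^[k] (realHermite k)) = Polynomial.C (k.factorial : ℝ) := by
      have hd : (Polynomial.derivative^[k] (realHermite k)).natDegree ≤ 0 := by
        refine (Polynomial.natDegree_iterate_derivative _ _).trans ?_
        simp [realHermite_natDegree]
      rw [Polynomial.eq_C_of_natDegree_le_zero hd, Polynomial.coeff_iterate_derivative]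
      have := (realHermite_monic k).coeff_natDegree
      rw [realHermite_natDegree] at this
      simp [this, Nat.descFactorial_self]
    rw [h0]; simp

/-- The Hermite polynomials normalized in `L²` of the standard Gaussian. -/
noncomputable def hermiteN (k : ℕ) (x : ℝ) : ℝ := (realHermite k).eval x / √(k.factorial : ℝ)

theorem sqrt_factorial_pos (k : ℕ) : 0 < √(k.factorial : ℝ) :=
  Real.sqrt_pos.mpr (by exact_mod_cast k.factorial_pos)

theorem hermiteN_zero (x : ℝ) : hermiteN 0 x = 1 := by simp [hermiteN, realHermite_zero]

theorem hermiteN_one (x : ℝ) : hermiteN 1 x = x := by simp [hermiteN, realHermite]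

theorem sqrt_factorial_succ (k : ℕ) :
    √((k + 1).factorial : ℝ) = √((k : ℝ) + 1) * √(k.factorial : ℝ) := by
  rw [Nat.factorial_succ, Nat.cast_mul, Real.sqrt_mul (by positivity)]; push_cast; rfl

theorem hermiteN_succ_succ (k : ℕ) (x : ℝ) :
    √((k : ℝ) + 2) * hermiteN (k + 2) x = x * hermiteN (k + 1) x - √((k : ℝ) + 1) * hermiteN k x := by
  have h0 := sqrt_factorial_pos k
  have h1 : 0 < √((k : ℝ) + 1) := Real.sqrt_pos.mpr (by positivity)
  have h2 : 0 < √((k : ℝ) + 2) := Real.sqrt_pos.mpr (by positivity)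
  have e2 : √((k + 2).factorial : ℝ) = √((k : ℝ) + 2) * (√((k : ℝ) + 1) * √(k.factorial : ℝ)) := by
    rw [sqrt_factorial_succ (k + 1), sqrt_factorial_succ k]; push_cast; ring_nf
  simp only [hermiteN, e2, sqrt_factorial_succ k, realHermite_succ_succ]
  have hs : (k : ℝ) + 1 = √((k : ℝ) + 1) * √((k : ℝ) + 1) :=
    (Real.mul_self_sqrt (by positivity)).symm
  simp only [Polynomial.eval_sub, Polynomial.eval_mul, Polynomial.eval_X, Polynomial.eval_add,
    Polynomial.eval_natCast, Polynomial.eval_one]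
  field_simp
  rw [Real.sq_sqrt (by positivity)]
  ring

/-- After division by `√(k+2)` the normalized recurrence has coefficients of size at most `|x|` and
1, so no factorial growth appears. -/
theorem abs_hermiteN_le (k : ℕ) (x : ℝ) : |hermiteN k x| ≤ (1 + |x|) ^ k := by
  induction k using Nat.strong_induction_on with
  | _ k ih =>
    match k with
    | 0 => simp [hermiteN_zero]
    | 1 => simp [hermiteN_one]
    | k + 2 =>
      have h1 := ih (k + 1) (by omega)
      have h0 := ih k (by omega)
      have hs1 : √((k : ℝ) + 1) ≤ √((k : ℝ) + 2) := Real.sqrt_le_sqrt (by linarith)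
      have hs2 : 1 ≤ √((k : ℝ) + 2) := Real.one_le_sqrt.mpr (by linarith [k.cast_nonneg (α := ℝ)])
      have hrec := congrArg abs (hermiteN_succ_succ k x)
      rw [abs_mul, abs_of_nonneg (Real.sqrt_nonneg _)] at hrec
      have hx := abs_nonneg x
      set s := √((k : ℝ) + 2)
      have b : |x * hermiteN (k + 1) x - √((k : ℝ) + 1) * hermiteN k x| ≤
          s * (|x| * (1 + |x|) ^ (k + 1) + (1 + |x|) ^ k) := by
        refine (abs_sub _ _).trans ?_
        rw [abs_mul, abs_mul, abs_of_nonneg (Real.sqrt_nonneg _), mul_add]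
        refine add_le_add ?_ (by gcongr)
        calc |x| * |hermiteN (k + 1) x| ≤ 1 * (|x| * (1 + |x|) ^ (k + 1)) := by
              rw [one_mul]; gcongr
          _ ≤ s * (|x| * (1 + |x|) ^ (k + 1)) := by gcongr
      have h3 : |hermiteN (k + 2) x| ≤ |x| * (1 + |x|) ^ (k + 1) + (1 + |x|) ^ k := by
        rw [← hrec] at b
        exact le_of_mul_le_mul_left b (by linarith)
      refine h3.trans ?_
      have : (1 + |x|) ^ k ≤ (1 + |x|) ^ (k + 1) := pow_le_pow_right₀ (by linarith) (by omega)
      calc _ ≤ |x| * (1 + |x|) ^ (k + 1) + (1 + |x|) ^ (k + 1) := by gcongr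
        _ = _ := by ring

/-- The recurrence is applied to the difference; each use adds one term `(x - y) * hermiteN (k + 1)
y`, which accounts for the factor `k`. -/
theorem abs_hermiteN_sub_le (k : ℕ) {x y R δ : ℝ} (hx : |x| ≤ R) (hy : |y| ≤ R)
    (hxy : |x - y| ≤ δ) : |hermiteN k x - hermiteN k y| ≤ δ * k * (R + 2) ^ k := by
  have hR : 0 ≤ R := (abs_nonneg x).trans hx
  have hδ : 0 ≤ δ := (abs_nonneg _).trans hxy
  induction k using Nat.strong_induction_on with
  | _ k ih =>
    match k with
    | 0 => simp [hermiteN_zero]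
    | 1 =>
      simp only [hermiteN_one, Nat.cast_one, mul_one, pow_one]
      nlinarith
    | k + 2 =>
      have h1 := ih (k + 1) (by omega)
      have h0 := ih k (by omega)
      have hs1 : √((k : ℝ) + 1) ≤ √((k : ℝ) + 2) := Real.sqrt_le_sqrt (by linarith)
      have hs2 : 1 ≤ √((k : ℝ) + 2) := Real.one_le_sqrt.mpr (by linarith [k.cast_nonneg (α := ℝ)])
      have hrec : √((k : ℝ) + 2) * |hermiteN (k + 2) x - hermiteN (k + 2) y| =
          |x * (hermiteN (k + 1) x - hermiteN (k + 1) y) + (x - y) * hermiteN (k + 1) y -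
            √((k : ℝ) + 1) * (hermiteN k x - hermiteN k y)| := by
        have hs : ∀ z, √((k : ℝ) + 2) * |z| = |√((k : ℝ) + 2) * z| := fun z => by
          rw [abs_mul, abs_of_nonneg (Real.sqrt_nonneg _)]
        rw [hs, mul_sub, hermiteN_succ_succ,
          hermiteN_succ_succ]
        ring_nf
      set s := √((k : ℝ) + 2)
      have hyb : |hermiteN (k + 1) y| ≤ (R + 2) ^ (k + 1) :=
        (abs_hermiteN_le _ _).trans (pow_le_pow_left₀ (by positivity) (by linarith) _)
      have b : s * |hermiteN (k + 2) x - hermiteN (k + 2) y| ≤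
          s * (R * (δ * (k + 1 : ℕ) * (R + 2) ^ (k + 1)) + δ * (R + 2) ^ (k + 1)
            + δ * k * (R + 2) ^ k) := by
        rw [hrec]
        refine (abs_sub _ _).trans ?_
        rw [mul_add]
        refine add_le_add ((abs_add_le _ _).trans ?_) ?_
        · rw [abs_mul, abs_mul]
          calc _ ≤ 1 * (R * (δ * (k + 1 : ℕ) * (R + 2) ^ (k + 1)) + δ * (R + 2) ^ (k + 1)) := by
                rw [one_mul]; gcongr
            _ ≤ _ := by gcongr
        · rw [abs_mul, abs_of_nonneg (Real.sqrt_nonneg _)]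
          gcongr
      refine (le_of_mul_le_mul_left b (by linarith)).trans ?_
      have h2 : (R + 2) ^ k ≤ (R + 2) ^ (k + 1) := pow_le_pow_right₀ (by linarith) (by omega)
      have h3 : δ * k * (R + 2) ^ k ≤ δ * k * (R + 2) ^ (k + 1) := by gcongr
      have hp : 0 ≤ δ * (R + 2) ^ (k + 1) := by positivity
      push_cast
      have hk : (0 : ℝ) ≤ k := k.cast_nonneg
      calc _ ≤ R * (δ * ((k : ℝ) + 1) * (R + 2) ^ (k + 1)) + δ * (R + 2) ^ (k + 1)
            + δ * k * (R + 2) ^ (k + 1) := by gcongr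
        _ = (δ * (R + 2) ^ (k + 1)) * (R * (k + 1) + 1 + k) := by ring
        _ ≤ (δ * (R + 2) ^ (k + 1)) * ((k + 2) * (R + 2)) := by
            gcongr; nlinarith
        _ = _ := by ring

theorem integral_hermiteN_mul_hermiteN (j k : ℕ) :
    ∫ x, hermiteN j x * hermiteN k x ∂(gaussianReal 0 1) = if j = k then 1 else 0 := by
  have e : ∀ x, hermiteN j x * hermiteN k x =
      (√(j.factorial : ℝ) * √(k.factorial : ℝ))⁻¹ * (realHermite j * realHermite k).eval x := by
    intro x
    have := sqrt_factorial_pos j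
    have := sqrt_factorial_pos k
    simp only [hermiteN, Polynomial.eval_mul]
    field_simp
  simp_rw [e]
  rw [integral_const_mul, integral_realHermite_mul_realHermite]
  split_ifs with h
  · subst h
    rw [Real.mul_self_sqrt (by positivity)]
    exact inv_mul_cancel₀ (by positivity)
  · simp

theorem integrable_hermiteN_mul_hermiteN (j k : ℕ) :
    Integrable (fun x => hermiteN j x * hermiteN k x) (gaussianReal 0 1) := by
  have e : (fun x => hermiteN j x * hermiteN k x) = fun x =>
      (√(j.factorial : ℝ) * √(k.factorial : ℝ))⁻¹ * (realHermite j * realHermite k).eval x := by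
    ext x
    have := sqrt_factorial_pos j
    have := sqrt_factorial_pos k
    simp only [hermiteN, Polynomial.eval_mul]
    field_simp
  rw [e]
  exact (integrable_polynomial_gaussianReal _).const_mul _

@[fun_prop]
theorem continuous_hermiteN (k : ℕ) : Continuous (hermiteN k) :=
  (realHermite k).continuous.div_const _

theorem eval_eq_sum_hermiteN (k : ℕ) (p : Polynomial ℝ) (hp : p.degree < k) :
    ∃ t : ℕ → ℝ, ∀ x : ℝ, p.eval x = ∑ j ∈ Finset.range k, t j * hermiteN j x := by
  induction k generalizing p with
  | zero =>
    have : p = 0 := by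
      rw [Polynomial.degree_lt_iff_coeff_zero] at hp
      ext m; simpa using hp m (by simp)
    exact ⟨0, fun x => by simp [this]⟩
  | succ k ih =>
    -- Monicity lets a multiple of `realHermite k` cancel the top coefficient.
    obtain ⟨t, ht⟩ := ih (p - Polynomial.C (p.coeff k) * realHermite k) (by
      rw [Polynomial.degree_lt_iff_coeff_zero] at hp ⊢
      intro m hm
      rw [Polynomial.coeff_sub, Polynomial.coeff_C_mul]
      rcases hm.lt_or_eq with h | rfl
      · rw [hp m h, Polynomial.coeff_eq_zero_of_natDegree_lt (p := realHermite k)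
          (by rwa [realHermite_natDegree])]
        simp
      · have := (realHermite_monic k).coeff_natDegree
        rw [realHermite_natDegree] at this
        simp [this])
    refine ⟨fun j => if j = k then p.coeff k * √(k.factorial : ℝ) else t j, fun x => ?_⟩
    rw [Finset.sum_range_succ]
    have h1 := ht x
    have h2 : ∑ j ∈ Finset.range k, (if j = k then p.coeff k * √(k.factorial : ℝ) else t j) *
        hermiteN j x = ∑ j ∈ Finset.range k, t j * hermiteN j x := by
      refine Finset.sum_congr rfl fun j hj => ?_
      rw [if_neg (Finset.mem_range.mp hj).ne]
    have := sqrt_factorial_pos k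
    rw [h2, ← h1]
    simp only [if_true, hermiteN, Polynomial.eval_sub, Polynomial.eval_mul, Polynomial.eval_C]
    field_simp
    ring

/-! ### Hermite expansion in several variables -/

/-- The product Hermite polynomial with multi-index `a`. -/
noncomputable def hermiteProd {n : ℕ} (a : Fin n → ℕ) (x : Fin n → ℝ) : ℝ :=
  ∏ i, hermiteN (a i) (x i)

@[fun_prop]
theorem continuous_hermiteProd {n : ℕ} (a : Fin n → ℕ) : Continuous (hermiteProd a) := by
  unfold hermiteProd; fun_prop

instance isProbabilityMeasure_stdGauss (n : ℕ) : IsProbabilityMeasure (stdGauss n) := by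
  unfold stdGauss; infer_instance

theorem abs_prod_le_pow_sum {ι : Type*} (s : Finset ι) {f : ι → ℝ} {k : ι → ℕ} {B : ℝ}
    (hf : ∀ i ∈ s, |f i| ≤ B ^ k i) : |∏ i ∈ s, f i| ≤ B ^ (∑ i ∈ s, k i) := by
  rw [Finset.abs_prod, ← Finset.prod_pow_eq_pow_sum]
  exact Finset.prod_le_prod (fun i _ => abs_nonneg _) hf

theorem abs_prod_sub_prod_le {ι : Type*} (s : Finset ι) {f g : ι → ℝ} {k : ι → ℕ} {B δ : ℝ}
    (hf : ∀ i ∈ s, |f i| ≤ B ^ k i) (hg : ∀ i ∈ s, |g i| ≤ B ^ k i)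
    (hfg : ∀ i ∈ s, |f i - g i| ≤ δ * k i * B ^ k i) (hB : 0 ≤ B) (hδ : 0 ≤ δ) :
    |∏ i ∈ s, f i - ∏ i ∈ s, g i| ≤ δ * (∑ i ∈ s, k i : ℕ) * B ^ (∑ i ∈ s, k i) := by
  classical
  induction s using Finset.induction_on with
  | empty => simp
  | insert i s hi ih =>
    have ih := ih (fun j hj => hf j (Finset.mem_insert_of_mem hj))
      (fun j hj => hg j (Finset.mem_insert_of_mem hj))
      (fun j hj => hfg j (Finset.mem_insert_of_mem hj))
    have hi1 := hfg i (Finset.mem_insert_self i s)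
    have hi2 := hg i (Finset.mem_insert_self i s)
    have hF := abs_prod_le_pow_sum s (fun j hj => hf j (Finset.mem_insert_of_mem hj))
    rw [Finset.prod_insert hi, Finset.prod_insert hi, Finset.sum_insert hi]
    set F := ∏ j ∈ s, f j
    set G := ∏ j ∈ s, g j
    set m := ∑ j ∈ s, k j
    calc |f i * F - g i * G| = |(f i - g i) * F + g i * (F - G)| := by ring_nf
      _ ≤ |f i - g i| * |F| + |g i| * |F - G| := by
        refine (abs_add_le _ _).trans ?_
        rw [abs_mul, abs_mul]
      _ ≤ δ * k i * B ^ k i * B ^ m + B ^ k i * (δ * m * B ^ m) := by gcongr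
      _ = _ := by push_cast; ring

theorem abs_hermiteProd_le {n : ℕ} (a : Fin n → ℕ) {x : Fin n → ℝ} {R : ℝ}
    (hx : ∀ i, a i ≠ 0 → |x i| ≤ R) : |hermiteProd a x| ≤ (1 + R) ^ (∑ i, a i) := by
  refine abs_prod_le_pow_sum _ fun i _ => ?_
  by_cases h : a i = 0
  · simp [h, hermiteN_zero]
  · exact (abs_hermiteN_le _ _).trans (pow_le_pow_left₀ (by positivity) (by linarith [hx i h]) _)

theorem abs_hermiteProd_sub_le {n : ℕ} (a : Fin n → ℕ) {x y : Fin n → ℝ} {R δ : ℝ} (hR : 0 ≤ R)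
    (hδ : 0 ≤ δ) (hx : ∀ i, a i ≠ 0 → |x i| ≤ R) (hy : ∀ i, a i ≠ 0 → |y i| ≤ R)
    (hxy : ∀ i, a i ≠ 0 → |x i - y i| ≤ δ) :
    |hermiteProd a x - hermiteProd a y| ≤ δ * (∑ i, a i : ℕ) * (R + 2) ^ (∑ i, a i) := by
  have hb : ∀ z : Fin n → ℝ, (∀ i, a i ≠ 0 → |z i| ≤ R) → ∀ i,
      |hermiteN (a i) (z i)| ≤ (R + 2) ^ a i := by
    intro z hz i
    by_cases h : a i = 0
    · simp [h, hermiteN_zero]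
    · exact (abs_hermiteN_le _ _).trans
        (pow_le_pow_left₀ (by positivity) (by linarith [hz i h]) _)
  refine abs_prod_sub_prod_le _ (fun i _ => hb x hx i) (fun i _ => hb y hy i) (fun i _ => ?_)
    (by linarith) hδ
  by_cases h : a i = 0
  · simp [h, hermiteN_zero]
  · exact abs_hermiteN_sub_le _ (hx i h) (hy i h) (hxy i h)

theorem integrable_hermiteProd_mul_hermiteProd {n : ℕ} (a b : Fin n → ℕ) :
    Integrable (fun x => hermiteProd a x * hermiteProd b x) (stdGauss n) := by
  simp only [hermiteProd, ← Finset.prod_mul_distrib]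
  exact Integrable.fintype_prod (f := fun i x => hermiteN (a i) x * hermiteN (b i) x)
    fun i => integrable_hermiteN_mul_hermiteN _ _

theorem integral_hermiteProd_mul_hermiteProd {n : ℕ} (a b : Fin n → ℕ) :
    ∫ x, hermiteProd a x * hermiteProd b x ∂(stdGauss n) = if a = b then 1 else 0 := by
  simp only [hermiteProd, ← Finset.prod_mul_distrib, stdGauss]
  rw [integral_fintype_prod_eq_prod (f := fun i x => hermiteN (a i) x * hermiteN (b i) x)]
  simp only [integral_hermiteN_mul_hermiteN]
  rw [Finset.prod_ite_zero]
  simp [funext_iff]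

/-- The multi-indices of total degree at most `d`. -/
def multiIndexLE (n : ℕ) : ℕ → Finset (Fin n → ℕ)
  | 0 => {0}
  | d + 1 => (Finset.univ ×ˢ multiIndexLE n d).image fun p : Option (Fin n) × (Fin n → ℕ) =>
      p.1.elim p.2 fun i => p.2 + Pi.single i 1

theorem mem_multiIndexLE {n d : ℕ} {a : Fin n → ℕ} : a ∈ multiIndexLE n d ↔ ∑ i, a i ≤ d := by
  induction d generalizing a with
  | zero =>
    simp [multiIndexLE, funext_iff]
  | succ d ih =>
    simp only [multiIndexLE, Finset.mem_image, Finset.mem_product, Finset.mem_univ, true_and,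
      Prod.exists]
    constructor
    · rintro ⟨o, b, hb, rfl⟩
      rw [ih] at hb
      cases o with
      | none => simpa using hb.trans (Nat.le_succ d)
      | some i =>
        simp only [Option.elim, Pi.add_apply, Finset.sum_add_distrib]
        simpa using hb
    · intro h
      by_cases h0 : ∀ i, a i = 0
      · exact ⟨none, a, ih.mpr (by simp [h0]), rfl⟩
      · push Not at h0
        obtain ⟨i, hi⟩ := h0
        have e : a = a - Pi.single i 1 + Pi.single i 1 := by
          ext j
          by_cases hj : j = i
          · subst hj; simp; omega
          · simp [hj]
        refine ⟨some i, a - Pi.single i 1, ih.mpr ?_, e.symm⟩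
        have hs := congrArg (fun b : Fin n → ℕ => ∑ j, b j) e
        simp only [Pi.add_apply, Finset.sum_add_distrib, Finset.sum_pi_single', Finset.mem_univ,
          if_true] at hs
        have : ∑ j, (Pi.single i 1 : Fin n → ℕ) j = 1 := by simp
        omega

/-- Each step of the recursion offers `n + 1` choices: add nothing, or add one unit to one of `n`
coordinates. -/
theorem card_multiIndexLE_le (n d : ℕ) : (multiIndexLE n d).card ≤ (n + 1) ^ d := by
  induction d with
  | zero => simp [multiIndexLE]
  | succ d ih =>
    refine Finset.card_image_le.trans ?_
    rw [Finset.card_product, pow_succ, mul_comm]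
    simpa using Nat.mul_le_mul_right (n + 1) ih

/-- Each power of a variable expands in Hermite polynomials of no larger degree, so a monomial only
meets multi-indices below its exponent. -/
theorem eval_eq_sum_hermiteProd {n d : ℕ} (q : MvPolynomial (Fin n) ℝ) (hq : q.totalDegree ≤ d) :
    ∃ c : (Fin n → ℕ) → ℝ, ∀ x, MvPolynomial.eval x q =
      ∑ a ∈ multiIndexLE n d, c a * hermiteProd a x := by
  have hpow : ∀ k : ℕ, ∃ t : ℕ → ℝ, ∀ x : ℝ, x ^ k = ∑ j ∈ Finset.range (k + 1), t j * hermiteN j x := by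
    intro k
    obtain ⟨t, ht⟩ := eval_eq_sum_hermiteN (k + 1) (Polynomial.X ^ k) (by
      rw [Polynomial.degree_X_pow]; exact_mod_cast k.lt_succ_self)
    exact ⟨t, fun x => by simpa using ht x⟩
  choose t ht using hpow
  let V : Submodule ℝ ((Fin n → ℝ) → ℝ) :=
    Submodule.span ℝ (hermiteProd '' (multiIndexLE n d : Set (Fin n → ℕ)))
  have hV : (fun x => MvPolynomial.eval x q) ∈ V := by
    have e : (fun x : Fin n → ℝ => MvPolynomial.eval x q) = ∑ m ∈ q.support,
        q.coeff m • ∑ p ∈ Fintype.piFinset fun i => Finset.range (m i + 1),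
          (∏ i, t (m i) (p i)) • hermiteProd p := by
      ext x
      rw [MvPolynomial.eval_eq']
      simp only [Finset.sum_apply, Pi.smul_apply, smul_eq_mul]
      refine Finset.sum_congr rfl fun m _ => ?_
      congr 1
      calc ∏ i, x i ^ m i = ∏ i, ∑ j ∈ Finset.range (m i + 1), t (m i) j * hermiteN j (x i) :=
            Finset.prod_congr rfl fun i _ => ht _ _
        _ = _ := by
          rw [Finset.prod_univ_sum]
          simp only [Finset.prod_mul_distrib, hermiteProd]
    rw [e]
    refine Submodule.sum_mem _ fun m hm => Submodule.smul_mem _ _ (Submodule.sum_mem _ fun p hp =>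
      Submodule.smul_mem _ _ (Submodule.subset_span ⟨p, ?_, rfl⟩))
    rw [Finset.mem_coe, mem_multiIndexLE]
    have h1 := (MvPolynomial.le_totalDegree hm).trans hq
    rw [Finsupp.sum_fintype _ _ (by simp)] at h1
    refine (Finset.sum_le_sum fun i _ => ?_).trans h1
    have := Fintype.mem_piFinset.mp hp i
    simpa [Nat.lt_succ_iff] using this
  rw [Submodule.mem_span_image_finset_iff_exists_fun] at hV
  obtain ⟨c, hc⟩ := hV
  refine ⟨fun a => if h : a ∈ multiIndexLE n d then c ⟨a, h⟩ else 0, fun x => ?_⟩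
  have := congrFun hc x
  rw [← Finset.sum_coe_sort (multiIndexLE n d)]
  simpa using this.symm

theorem integral_sum_hermiteProd_sq {n : ℕ} (A : Finset (Fin n → ℕ)) (c : (Fin n → ℕ) → ℝ) :
    ∫ x, (∑ a ∈ A, c a * hermiteProd a x) ^ 2 ∂(stdGauss n) = ∑ a ∈ A, c a ^ 2 := by
  have e : ∀ x : Fin n → ℝ, (∑ a ∈ A, c a * hermiteProd a x) ^ 2 =
      ∑ a ∈ A, ∑ b ∈ A, c a * c b * (hermiteProd a x * hermiteProd b x) := by
    intro x
    rw [sq, Finset.sum_mul_sum]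
    refine Finset.sum_congr rfl fun a _ => Finset.sum_congr rfl fun b _ => by ring
  simp_rw [e]
  have hi : ∀ a b : Fin n → ℕ, Integrable
      (fun x => c a * c b * (hermiteProd a x * hermiteProd b x)) (stdGauss n) :=
    fun a b => (integrable_hermiteProd_mul_hermiteProd a b).const_mul _
  rw [integral_finsetSum _ fun a _ => integrable_finsetSum _ fun b _ => hi a b]
  refine Finset.sum_congr rfl fun a ha => ?_
  rw [integral_finsetSum _ fun b _ => hi a b]
  simp_rw [integral_const_mul, integral_hermiteProd_mul_hermiteProd]
  simp [ha, sq]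

/-- By Parseval, `|q|₂²` is the sum of the squared coefficients. -/
theorem abs_coeff_le_gaussL2 {n : ℕ} {q : MvPolynomial (Fin n) ℝ} {A : Finset (Fin n → ℕ)}
    {c : (Fin n → ℕ) → ℝ} (h : ∀ x, MvPolynomial.eval x q = ∑ a ∈ A, c a * hermiteProd a x)
    {a : Fin n → ℕ} (ha : a ∈ A) : |c a| ≤ gaussL2 q := by
  refine Real.abs_le_sqrt ?_
  simp_rw [h]
  rw [integral_sum_hermiteProd_sq]
  exact Finset.single_le_sum (f := fun a => c a ^ 2) (fun b _ => sq_nonneg _) ha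

theorem memLp_two_hermiteProd {n : ℕ} (a : Fin n → ℕ) : MemLp (hermiteProd a) 2 (stdGauss n) := by
  rw [memLp_two_iff_integrable_sq (continuous_hermiteProd a).aestronglyMeasurable]
  simpa [sq] using integrable_hermiteProd_mul_hermiteProd a a

theorem memLp_two_eval {n : ℕ} (q : MvPolynomial (Fin n) ℝ) :
    MemLp (fun x => MvPolynomial.eval x q) 2 (stdGauss n) := by
  obtain ⟨c, hc⟩ := eval_eq_sum_hermiteProd q le_rfl
  simp_rw [hc]
  exact memLp_finsetSum _ fun a _ => (memLp_two_hermiteProd a).const_mul _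

/-! ### Anticoncentration of quadratic polynomials of Gaussians -/

/-- The bound `ρ` on the density is kept variable: for a tiny leading coefficient the Gaussian decay
has to compensate for a large volume. -/
theorem gaussianReal_le_mul_volume {S : Set ℝ} (hS : MeasurableSet S) {ρ : ℝ}
    (h : ∀ t ∈ S, Real.exp (-t ^ 2 / 2) ≤ ρ) :
    gaussianReal 0 1 S ≤ ENNReal.ofReal ρ * volume S := by
  rw [gaussianReal_apply _ one_ne_zero, ← setLIntegral_const]
  refine setLIntegral_mono' hS fun t ht => ?_
  refine ENNReal.ofReal_le_ofReal ((?_ : _ ≤ _).trans (h t ht))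
  have h1 : 1 ≤ √(2 * Real.pi) := Real.one_le_sqrt.mpr (by linarith [Real.pi_gt_three])
  rw [gaussianPDFReal]
  simp only [NNReal.coe_one, mul_one, sub_zero]
  calc _ ≤ 1 * Real.exp (-t ^ 2 / 2) := by
        gcongr; exact inv_le_one_of_one_le₀ h1
    _ = _ := one_mul _

/-- On one side of the vertex `x₀`, two points satisfy `|l| (t - u)² ≤ |f t - f u| ≤ 2η`, so each
half of the set has diameter at most `√(2η/|l|)`. -/
theorem volume_quadratic_le {l : ℝ} (hl : l ≠ 0) (β c η : ℝ) :
    volume {t : ℝ | |l * t ^ 2 + β * t + c| ≤ η} ≤ ENNReal.ofReal (2 * √(2 * η / |l|)) := by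
  set S := {t : ℝ | |l * t ^ 2 + β * t + c| ≤ η}
  have hl' : 0 < |l| := abs_pos.mpr hl
  set x₀ := -β / (2 * l) with hx₀
  have hβ : β = -2 * l * x₀ := by rw [hx₀]; field_simp
  have key : ∀ t ∈ S, ∀ u ∈ S, |t - u| ≤ |t - x₀ + (u - x₀)| → |t - u| ≤ √(2 * η / |l|) := by
    intro t ht u hu h
    refine Real.abs_le_sqrt ?_
    rw [le_div_iff₀ hl']
    have h1 : |(l * t ^ 2 + β * t + c) - (l * u ^ 2 + β * u + c)| ≤ 2 * η := by
      refine (abs_sub _ _).trans ?_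
      have : |l * t ^ 2 + β * t + c| ≤ η := ht
      have : |l * u ^ 2 + β * u + c| ≤ η := hu
      linarith
    have h2 : (l * t ^ 2 + β * t + c) - (l * u ^ 2 + β * u + c) =
        l * ((t - u) * (t - x₀ + (u - x₀))) := by rw [hβ]; ring
    rw [h2, abs_mul, abs_mul] at h1
    calc (t - u) ^ 2 * |l| = |l| * (|t - u| * |t - u|) := by rw [abs_mul_abs_self]; ring
      _ ≤ |l| * (|t - u| * |t - x₀ + (u - x₀)|) := by gcongr
      _ ≤ _ := h1
  have hsub : S ⊆ (S ∩ Set.Ici x₀) ∪ (S ∩ Set.Iic x₀) := by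
    intro t ht
    rcases le_total x₀ t with h | h
    · exact Or.inl ⟨ht, h⟩
    · exact Or.inr ⟨ht, h⟩
  have hs0 := Real.sqrt_nonneg (2 * η / |l|)
  have half : ∀ I : Set ℝ, (∀ t ∈ S ∩ I, ∀ u ∈ S ∩ I, |t - u| ≤ |t - x₀ + (u - x₀)|) →
      volume (S ∩ I) ≤ ENNReal.ofReal √(2 * η / |l|) := by
    intro I hI
    refine (Real.volume_le_diam _).trans (Metric.ediam_le fun t ht u hu => ?_)
    rw [edist_dist, Real.dist_eq]
    exact ENNReal.ofReal_le_ofReal (key t ht.1 u hu.1 (hI t ht u hu))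
  refine (measure_mono hsub).trans ((measure_union_le _ _).trans ?_)
  rw [two_mul, ENNReal.ofReal_add hs0 hs0]
  refine add_le_add (half _ fun t ht u hu => ?_) (half _ fun t ht u hu => ?_)
  · have h1 : x₀ ≤ t := ht.2
    have h2 : x₀ ≤ u := hu.2
    rw [abs_of_nonneg (by linarith : 0 ≤ t - x₀ + (u - x₀)), abs_le]
    constructor <;> linarith
  · have h1 : t ≤ x₀ := ht.2
    have h2 : u ≤ x₀ := hu.2
    rw [abs_of_nonpos (by linarith : t - x₀ + (u - x₀) ≤ 0), abs_le]
    constructor <;> linarith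

/-- Far out, where `|t| ≥ 1/(4|l|)`, the density is `O(√|l|)`; this cancels the factor `|l|^(-1/2)`
in `volume_quadratic_le`. -/
theorem exp_neg_sq_half_le {l t : ℝ} (h : 1 ≤ 4 * |l| * |t|) :
    Real.exp (-t ^ 2 / 2) ≤ 2 * √|l| := by
  have e : 2 * √|l| = √(4 * |l|) := by
    rw [Real.sqrt_mul (by norm_num), show (4 : ℝ) = 2 ^ 2 by norm_num, Real.sqrt_sq (by norm_num)]
  rw [e]
  refine Real.le_sqrt_of_sq_le ?_
  have h1 : Real.exp (-t ^ 2 / 2) ^ 2 = (Real.exp (t ^ 2))⁻¹ := by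
    rw [← Real.exp_nat_mul, ← Real.exp_neg]; congr 1; push_cast; ring
  rw [h1]
  have h2 : |t| ≤ Real.exp (t ^ 2) := by
    have := Real.add_one_le_exp (t ^ 2)
    have h3 : t ^ 2 = |t| ^ 2 := (sq_abs t).symm
    nlinarith [sq_nonneg (|t| - 1), abs_nonneg t]
  have h0 : 0 < |t| := by
    rcases (abs_nonneg t).lt_or_eq with h0 | h0
    · exact h0
    · rw [← h0] at h; norm_num at h
  calc (Real.exp (t ^ 2))⁻¹ ≤ |t|⁻¹ := inv_anti₀ h0 h2
    _ ≤ 4 * |l| := by rw [inv_le_iff_one_le_mul₀ h0]; exact h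

/-- If `|l| ≥ 1/8`, the volume bound suffices. Otherwise `|β| ≥ 1`: where `4|l||t| ≤ 1` the linear
term dominates and secants have slope at least 1/2, and elsewhere the decay of the density takes
over. -/
theorem gaussianReal_quadratic_le {l β : ℝ} (h : 1 ≤ |l| ∨ 1 ≤ |β|) (c : ℝ) {η : ℝ} (hη : 0 ≤ η) :
    gaussianReal 0 1 {t : ℝ | |l * t ^ 2 + β * t + c| ≤ η} ≤ ENNReal.ofReal (10 * √η) := by
  set S := {t : ℝ | |l * t ^ 2 + β * t + c| ≤ η}
  have hS : MeasurableSet S := measurableSet_le (by fun_prop) measurable_const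
  have hη' := Real.sqrt_nonneg η
  rcases le_or_gt 1 η with h1 | h1
  · refine prob_le_one.trans ?_
    have : 1 ≤ √η := Real.one_le_sqrt.mpr h1
    rw [← ENNReal.ofReal_one]
    exact ENNReal.ofReal_le_ofReal (by linarith)
  have hηs : η ≤ √η := Real.le_sqrt_of_sq_le (by nlinarith)
  rcases le_or_gt (1 / 8) |l| with hl | hl
  · have hl0 : l ≠ 0 := by rintro rfl; norm_num at hl
    refine (gaussianReal_le_mul_volume hS (ρ := 1) fun t _ => ?_).trans ?_
    · rw [Real.exp_le_one_iff]; nlinarith [sq_nonneg t]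
    · rw [ENNReal.ofReal_one, one_mul]
      refine (volume_quadratic_le hl0 β c η).trans (ENNReal.ofReal_le_ofReal ?_)
      have : √(2 * η / |l|) ≤ √(4 ^ 2 * η) := by
        refine Real.sqrt_le_sqrt ?_
        rw [div_le_iff₀ (by linarith)]
        nlinarith
      rw [Real.sqrt_mul (by norm_num), Real.sqrt_sq (by norm_num)] at this
      linarith
  · have hβ : 1 ≤ |β| := h.resolve_left (by linarith)
    have hsub : S ⊆ (S ∩ {t | 4 * |l| * |t| ≤ 1}) ∪ (S ∩ {t | 1 < 4 * |l| * |t|}) := by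
      intro t ht
      rcases le_or_gt (4 * |l| * |t|) 1 with h | h
      · exact Or.inl ⟨ht, h⟩
      · exact Or.inr ⟨ht, h⟩
    refine (measure_mono hsub).trans ((measure_union_le _ _).trans ?_)
    rw [show 10 * √η = 4 * √η + 6 * √η by ring, ENNReal.ofReal_add (by positivity) (by positivity)]
    refine add_le_add ?_ ?_
    · refine (gaussianReal_le_mul_volume
        (hS.inter (measurableSet_le (by fun_prop) measurable_const)) (ρ := 1) fun t _ => ?_).trans ?_
      · rw [Real.exp_le_one_iff]; nlinarith [sq_nonneg t]
      rw [ENNReal.ofReal_one, one_mul]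
      refine (Real.volume_le_diam _).trans (Metric.ediam_le fun t ht u hu => ?_)
      rw [edist_dist, Real.dist_eq]
      refine ENNReal.ofReal_le_ofReal (le_trans ?_ (mul_le_mul_of_nonneg_left hηs (by norm_num)))
      have h1 : |(l * t ^ 2 + β * t + c) - (l * u ^ 2 + β * u + c)| ≤ 2 * η := by
        refine (abs_sub _ _).trans ?_
        have : |l * t ^ 2 + β * t + c| ≤ η := ht.1
        have : |l * u ^ 2 + β * u + c| ≤ η := hu.1
        linarith
      have h2 : (l * t ^ 2 + β * t + c) - (l * u ^ 2 + β * u + c) =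
          (t - u) * (β + (l * t + l * u)) := by ring
      rw [h2, abs_mul] at h1
      have ht2 : 4 * |l| * |t| ≤ 1 := ht.2
      have hu2 : 4 * |l| * |u| ≤ 1 := hu.2
      have h3 : 1 / 2 ≤ |β + (l * t + l * u)| := by
        have a1 := abs_sub_abs_le_abs_sub β (-(l * t + l * u))
        rw [abs_neg, sub_neg_eq_add] at a1
        have a2 := abs_add_le (l * t) (l * u)
        rw [abs_mul, abs_mul] at a2
        linarith
      nlinarith [abs_nonneg (t - u)]
    · rcases eq_or_ne l 0 with rfl | hl0
      · have : ¬ ((1 : ℝ) < 0) := by norm_num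
        simp [this]
      have hl0' : 0 < |l| := abs_pos.mpr hl0
      refine (gaussianReal_le_mul_volume
        (hS.inter (measurableSet_lt measurable_const (by fun_prop))) (ρ := 2 * √|l|)
        fun t ht => exp_neg_sq_half_le ht.2.le).trans ?_
      refine (mul_le_mul_right ((measure_mono Set.inter_subset_left).trans
        (volume_quadratic_le hl0 β c η)) _).trans ?_
      rw [← ENNReal.ofReal_mul (by positivity)]
      refine ENNReal.ofReal_le_ofReal ?_
      have e1 : √|l| * √(2 * η / |l|) = √2 * √η := by
        rw [← Real.sqrt_mul (by positivity), ← Real.sqrt_mul (by norm_num)]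
        congr 1; field_simp
      have e2 : √2 ≤ 3 / 2 := Real.sqrt_le_iff.mpr (by norm_num)
      calc 2 * √|l| * (2 * √(2 * η / |l|)) = 4 * (√|l| * √(2 * η / |l|)) := by ring
        _ = 4 * (√2 * √η) := by rw [e1]
        _ ≤ 4 * (3 / 2 * √η) := by gcongr
        _ = _ := by ring

/-- With all coordinates but `i` frozen, the function is a one-variable quadratic with an arbitrary
constant term, and the one-variable bound is uniform in that term. -/
theorem stdGauss_diagonal_quadratic_le {n : ℕ} (l β : Fin n → ℝ) (c : ℝ) {η : ℝ} (hη : 0 ≤ η)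
    (h : ∃ i, 1 ≤ |l i| ∨ 1 ≤ |β i|) :
    stdGauss n {x | |∑ i, (l i * x i ^ 2 + β i * x i) + c| ≤ η} ≤ ENNReal.ofReal (10 * √η) := by
  obtain ⟨i, hi⟩ := h
  obtain ⟨m, rfl⟩ : ∃ m, n = m + 1 := ⟨n - 1, by have := i.pos; omega⟩
  have hmp := measurePreserving_piFinSuccAbove (fun _ : Fin (m + 1) => gaussianReal 0 1) i
  let T : Set (ℝ × (Fin m → ℝ)) := {p | |l i * p.1 ^ 2 + β i * p.1 +
    (∑ j, (l (i.succAbove j) * p.2 j ^ 2 + β (i.succAbove j) * p.2 j) + c)| ≤ η}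
  have hT : MeasurableSet T := measurableSet_le (by fun_prop) measurable_const
  have e : {x : Fin (m + 1) → ℝ | |∑ i, (l i * x i ^ 2 + β i * x i) + c| ≤ η} =
      (MeasurableEquiv.piFinSuccAbove (fun _ => ℝ) i) ⁻¹' T := by
    ext x
    simp only [Set.mem_ofPred_eq, Set.mem_preimage, T, Fin.sum_univ_succAbove _ i]
    simp [MeasurableEquiv.piFinSuccAbove, Fin.insertNthEquiv, Fin.removeNth, add_assoc]
  rw [e, stdGauss, hmp.measure_preimage hT.nullMeasurableSet, Measure.prod_apply_symm hT]
  have hfib : ∀ y : Fin m → ℝ, gaussianReal 0 1 ((fun t => (t, y)) ⁻¹' T) ≤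
      ENNReal.ofReal (10 * √η) := by
    intro y
    have hy : (fun t => (t, y)) ⁻¹' T = {t : ℝ | |l i * t ^ 2 + β i * t +
        (∑ j, (l (i.succAbove j) * y j ^ 2 + β (i.succAbove j) * y j) + c)| ≤ η} := by
      ext t
      simp only [T, Set.mem_preimage, Set.mem_ofPred_eq]
    rw [hy]
    exact gaussianReal_quadratic_le hi _ hη
  refine (lintegral_mono hfib).trans ?_
  rw [lintegral_const, measure_univ, mul_one]

/-- The value of a diagonalized quadratic polynomial in an orthonormal basis. -/
noncomputable def diagQuad {n : ℕ} (b : OrthonormalBasis (Fin n) ℝ (EuclideanSpace ℝ (Fin n)))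
    (l β : Fin n → ℝ) (c : ℝ) (x : EuclideanSpace ℝ (Fin n)) : ℝ :=
  ∑ i, (l i * inner ℝ (b i) x ^ 2 + β i * inner ℝ (b i) x) + c

theorem continuous_diagQuad {n : ℕ} (b : OrthonormalBasis (Fin n) ℝ (EuclideanSpace ℝ (Fin n)))
    (l β : Fin n → ℝ) (c : ℝ) : Continuous (diagQuad b l β c) := by
  unfold diagQuad; fun_prop

theorem stdGauss_diagQuad_le {n : ℕ} (b : OrthonormalBasis (Fin n) ℝ (EuclideanSpace ℝ (Fin n)))
    (l β : Fin n → ℝ) (c : ℝ) {η : ℝ} (hη : 0 ≤ η) (h : ∃ i, 1 ≤ |l i| ∨ 1 ≤ |β i|) :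
    stdGauss n {x | |diagQuad b l β c (WithLp.toLp 2 x)| ≤ η} ≤ ENNReal.ofReal (10 * √η) := by
  refine le_trans (le_of_eq ?_) (stdGauss_diagonal_quadratic_le l β c hη h)
  have hm : MeasurableSet {y | |diagQuad b l β c y| ≤ η} :=
    measurableSet_le (continuous_diagQuad b l β c).abs.measurable measurable_const
  -- Rotation invariance: independent standard coordinates in the basis `b` give the same law as in
  -- the standard basis.
  have h1 := map_pi_eq_stdGaussian (ι := Fin n)
  rw [stdGaussian_eq_map_pi_orthonormalBasis b] at h1
  have h2 := congrArg (fun μ => μ {y | |diagQuad b l β c y| ≤ η}) h1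
  simp only at h2
  rw [Measure.map_apply (by fun_prop) hm, Measure.map_apply (by fun_prop) hm] at h2
  refine h2.trans (congrArg _ ?_)
  ext x
  have : ∀ i, inner ℝ (b i) (∑ j, x j • b j) = x i := fun i => by
    simp [inner_sum, inner_smul_right, orthonormal_iff_ite.mp b.orthonormal]
  simp [diagQuad, this]

/-- Each term factors as a difference of squares, and Cauchy-Schwarz is applied over the basis; `√n`
comes from the linear coefficients. -/
theorem abs_diagQuad_sub_le {n : ℕ} (b : OrthonormalBasis (Fin n) ℝ (EuclideanSpace ℝ (Fin n)))
    {l β : Fin n → ℝ} (c : ℝ) (hl : ∀ i, |l i| ≤ 1) (hβ : ∀ i, |β i| ≤ 1)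
    (x y : EuclideanSpace ℝ (Fin n)) :
    |diagQuad b l β c x - diagQuad b l β c y| ≤ ‖x - y‖ * (‖x‖ + ‖y‖ + √n) := by
  have hn : ∀ z, √(∑ i, |inner ℝ (b i) z| ^ 2) = ‖z‖ := fun z => by
    have := b.sum_sq_norm_inner_right z
    simp only [Real.norm_eq_abs] at this
    rw [this, Real.sqrt_sq (norm_nonneg _)]
  have cs : ∀ f : Fin n → ℝ, ∑ i, |inner ℝ (b i) (x - y)| * f i ≤ ‖x - y‖ * √(∑ i, f i ^ 2) := by
    intro f
    rw [← hn (x - y)]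
    exact Real.sum_mul_le_sqrt_mul_sqrt _ _ _
  have h1 : |diagQuad b l β c x - diagQuad b l β c y| ≤
      ∑ i, |inner ℝ (b i) (x - y)| * (|inner ℝ (b i) x| + |inner ℝ (b i) y| + 1) := by
    have e : diagQuad b l β c x - diagQuad b l β c y = ∑ i, (inner ℝ (b i) (x - y) *
        (l i * (inner ℝ (b i) x + inner ℝ (b i) y) + β i)) := by
      simp only [diagQuad, add_sub_add_right_eq_sub, ← Finset.sum_sub_distrib, inner_sub_right]
      exact Finset.sum_congr rfl fun i _ => by ring
    rw [e]
    refine (Finset.abs_sum_le_sum_abs _ _).trans (Finset.sum_le_sum fun i _ => ?_)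
    rw [abs_mul]
    refine mul_le_mul_of_nonneg_left ((abs_add_le _ _).trans (add_le_add ?_ (hβ i))) (abs_nonneg _)
    rw [abs_mul]
    calc _ ≤ 1 * (|inner ℝ (b i) x| + |inner ℝ (b i) y|) :=
          mul_le_mul (hl i) (abs_add_le _ _) (abs_nonneg _) zero_le_one
      _ = _ := one_mul _
  refine h1.trans ?_
  simp only [mul_add, Finset.sum_add_distrib]
  refine add_le_add (add_le_add ?_ ?_) ?_
  · exact (cs _).trans (by rw [hn])
  · exact (cs _).trans (by rw [hn])
  · exact (cs _).trans (by simp)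

/-! ### Diagonalization of polynomials of degree two -/

/-- The function is a quadratic form plus an affine function. -/
def IsQuadraticFn {n : ℕ} (f : EuclideanSpace ℝ (Fin n) → ℝ) : Prop :=
  ∃ (T : EuclideanSpace ℝ (Fin n) →ₗ[ℝ] EuclideanSpace ℝ (Fin n)) (β : EuclideanSpace ℝ (Fin n))
    (c : ℝ), T.IsSymmetric ∧ ∀ x, f x = inner ℝ (T x) x + inner ℝ β x + c

theorem IsQuadraticFn.add {n : ℕ} {f g : EuclideanSpace ℝ (Fin n) → ℝ} (hf : IsQuadraticFn f)
    (hg : IsQuadraticFn g) : IsQuadraticFn (fun x => f x + g x) := by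
  obtain ⟨T, β, c, hT, h⟩ := hf
  obtain ⟨T', β', c', hT', h'⟩ := hg
  refine ⟨T + T', β + β', c + c', hT.add hT', fun x => ?_⟩
  simp only [h, h']
  rw [LinearMap.add_apply, inner_add_left, inner_add_left]
  ring

theorem IsQuadraticFn.const_mul {n : ℕ} {f : EuclideanSpace ℝ (Fin n) → ℝ} (hf : IsQuadraticFn f)
    (a : ℝ) : IsQuadraticFn (fun x => a * f x) := by
  obtain ⟨T, β, c, hT, h⟩ := hf
  refine ⟨a • T, a • β, a * c, hT.smul (by simp), fun x => ?_⟩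
  simp only [h]
  rw [LinearMap.smul_apply, inner_smul_left, inner_smul_left]
  simp
  ring

theorem isQuadraticFn_const {n : ℕ} (c : ℝ) :
    IsQuadraticFn (fun _ : EuclideanSpace ℝ (Fin n) => c) :=
  ⟨0, 0, c, LinearMap.IsSymmetric.zero, fun x => by simp⟩

theorem isQuadraticFn_coord {n : ℕ} (i : Fin n) :
    IsQuadraticFn (fun x : EuclideanSpace ℝ (Fin n) => x i) :=
  ⟨0, EuclideanSpace.single i 1, 0, LinearMap.IsSymmetric.zero, fun x => by
    simp [EuclideanSpace.inner_single_left]⟩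

theorem isQuadraticFn_coord_mul_coord {n : ℕ} (i j : Fin n) :
    IsQuadraticFn (fun x : EuclideanSpace ℝ (Fin n) => x i * x j) := by
  -- The symmetrized rank-one operator, so that the spectral theorem applies.
  refine ⟨(1 / 2 : ℝ) • ((EuclideanSpace.proj (𝕜 := ℝ) i).toLinearMap.smulRight
      (EuclideanSpace.single j (1 : ℝ)) + (EuclideanSpace.proj (𝕜 := ℝ) j).toLinearMap.smulRight
      (EuclideanSpace.single i (1 : ℝ))), 0, 0, fun x y => ?_, fun x => ?_⟩
  · simp [inner_add_left, inner_add_right, inner_smul_left, inner_smul_right,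
      EuclideanSpace.inner_single_left, EuclideanSpace.inner_single_right]
    ring
  · simp [inner_add_left, inner_smul_left, EuclideanSpace.inner_single_left]
    ring

theorem IsQuadraticFn.sum {n : ℕ} {ι : Type*} (A : Finset ι)
    {f : ι → EuclideanSpace ℝ (Fin n) → ℝ} (hf : ∀ i ∈ A, IsQuadraticFn (f i)) :
    IsQuadraticFn (fun x => ∑ i ∈ A, f i x) := by
  classical
  induction A using Finset.induction_on with
  | empty => simpa using isQuadraticFn_const 0
  | insert i A hi ih =>
    simp only [Finset.sum_insert hi]
    exact (hf i (Finset.mem_insert_self _ _)).add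
      (ih fun j hj => hf j (Finset.mem_insert_of_mem hj))

theorem isQuadraticFn_eval {n : ℕ} (s : MvPolynomial (Fin n) ℝ) (hs : s.totalDegree ≤ 2) :
    IsQuadraticFn (fun x : EuclideanSpace ℝ (Fin n) => MvPolynomial.eval x.ofLp s) := by
  simp only [MvPolynomial.eval_eq']
  refine IsQuadraticFn.sum _ fun m hm => IsQuadraticFn.const_mul ?_ _
  have h1 := (MvPolynomial.le_totalDegree hm).trans hs
  rw [Finsupp.sum_fintype _ _ (by simp)] at h1
  -- A monomial of degree at most two is reduced by removing one variable at a time; after two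
  -- removals nothing is left.
  have peel : ∀ k : Fin n →₀ ℕ, k ≠ 0 → ∃ i k', k = Finsupp.single i 1 + k' := by
    intro k hk
    obtain ⟨i, hi⟩ := Finsupp.ne_iff.mp hk
    refine ⟨i, k - Finsupp.single i 1, (add_tsub_cancel_of_le ?_).symm⟩
    rw [Finsupp.single_le_iff]
    exact Nat.one_le_iff_ne_zero.mpr hi
  have hprod : ∀ (i : Fin n) (k : Fin n →₀ ℕ) (x : EuclideanSpace ℝ (Fin n)),
      ∏ j, x j ^ (Finsupp.single i 1 + k : Fin n →₀ ℕ) j = x i * ∏ j, x j ^ k j := by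
    intro i k x
    simp only [Finsupp.add_apply, pow_add, Finset.prod_mul_distrib]
    congr 1
    rw [Finset.prod_eq_single i]
    · simp
    · intro j _ hj; simp [hj.symm]
    · simp
  have hdeg : ∀ (i : Fin n) (k : Fin n →₀ ℕ), ∑ j, (Finsupp.single i 1 + k : Fin n →₀ ℕ) j = 1 + ∑ j, k j := by
    intro i k
    simp [Finset.sum_add_distrib, Finsupp.single_apply]
  rcases eq_or_ne m 0 with rfl | h0
  · simpa using isQuadraticFn_const 1
  obtain ⟨i, k, rfl⟩ := peel m h0
  rw [hdeg] at h1
  simp only [hprod]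
  rcases eq_or_ne k 0 with rfl | h0
  · simpa using isQuadraticFn_coord i
  obtain ⟨j, k', rfl⟩ := peel k h0
  rw [hdeg] at h1
  simp only [hprod]
  have : k' = 0 := by
    ext a
    have : k' a ≤ ∑ j, k' j := Finset.single_le_sum (fun _ _ => Nat.zero_le _) (Finset.mem_univ a)
    simp; omega
  subst this
  simpa using isQuadraticFn_coord_mul_coord i j

theorem exists_eval_eq_diagQuad {n : ℕ} (s : MvPolynomial (Fin n) ℝ) (hs : s.totalDegree ≤ 2) :
    ∃ (b : OrthonormalBasis (Fin n) ℝ (EuclideanSpace ℝ (Fin n))) (l β : Fin n → ℝ) (c : ℝ),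
      ∀ x : EuclideanSpace ℝ (Fin n), MvPolynomial.eval x.ofLp s = diagQuad b l β c x := by
  obtain ⟨T, β, c, hT, h⟩ := isQuadraticFn_eval s hs
  have hn : Module.finrank ℝ (EuclideanSpace ℝ (Fin n)) = n := by simp
  refine ⟨hT.eigenvectorBasis hn, hT.eigenvalues hn,
    fun i => inner ℝ β (hT.eigenvectorBasis hn i), c, fun x => ?_⟩
  rw [show MvPolynomial.eval x.ofLp s = _ from h x, diagQuad, Finset.sum_add_distrib, OrthonormalBasis.sum_inner_mul_inner,
    ← (hT.eigenvectorBasis hn).sum_inner_mul_inner (T x) x]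
  congr 2
  refine Finset.sum_congr rfl fun i _ => ?_
  rw [hT, hT.apply_eigenvectorBasis, inner_smul_right, real_inner_comm]
  simp
  ring

/-! ### Indicators of quadratic threshold events -/

theorem exists_endpoints_of_ordConnected {J : Set ℝ} (hJ : J.OrdConnected) :
    ∃ E : Finset ℝ, E.card ≤ 2 ∧ ∀ t ∈ J, ∀ u ∉ J, ∃ e ∈ E, e ∈ Set.uIcc t u := by
  classical
  -- The value at an unbounded end is junk but never used: a point outside `J` on one side of a
  -- point of `J` bounds `J` on that side.
  refine ⟨{sInf J, sSup J}, Finset.card_le_two, fun t ht u hu => ?_⟩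
  rcases le_total u t with h | h
  · refine ⟨sInf J, by simp, ?_⟩
    have hb : ∀ v ∈ J, u ≤ v := by
      intro v hv
      by_contra! hvu
      exact hu (hJ.out hv ht ⟨hvu.le, h⟩)
    rw [Set.uIcc_of_ge h]
    exact ⟨le_csInf ⟨t, ht⟩ hb, csInf_le ⟨u, hb⟩ ht⟩
  · refine ⟨sSup J, by simp, ?_⟩
    have hb : ∀ v ∈ J, v ≤ u := by
      intro v hv
      by_contra! hvu
      exact hu (hJ.out ht hv ⟨h, hvu.le⟩)
    rw [Set.uIcc_of_le h]
    exact ⟨le_csSup ⟨u, hb⟩ ht, csSup_le ⟨t, ht⟩ hb⟩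

/-- A `0/1`-valued function that depends on the orthonormal linear forms `w`, and that can only
change between two points if the scale function `σ` crosses one of the at most two levels in `E`;
the scale function is locally Lipschitz and anticoncentrated around these levels. -/
structure ThresholdFn {n m : ℕ} (g : (Fin n → ℝ) → ℝ) (w : Fin m → EuclideanSpace ℝ (Fin n))
    (σ : EuclideanSpace ℝ (Fin n) → ℝ) (E : Finset ℝ) : Prop where
  orthonormal : Orthonormal ℝ w
  measurable : Measurable g
  zero_or_one : ∀ x, g x = 0 ∨ g x = 1
  continuous : Continuous σ
  card_le : E.card ≤ 2
  crossing : ∀ x y : EuclideanSpace ℝ (Fin n), g x.ofLp ≠ g y.ofLp →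
    ∃ e ∈ E, |σ x - e| ≤ |σ x - σ y|
  lipschitz : ∀ x y, |σ x - σ y| ≤ ‖x - y‖ * (‖x‖ + ‖y‖ + √n)
  anticoncentration : ∀ e ∈ E, ∀ η : ℝ, 0 ≤ η →
    stdGauss n {x | |σ (WithLp.toLp 2 x) - e| ≤ η} ≤ ENNReal.ofReal (10 * √η)
  proj_fn : ∀ x : EuclideanSpace ℝ (Fin n), g (∑ j, inner ℝ (w j) x • w j).ofLp = g x.ofLp
  proj_scale : ∀ x, σ (∑ j, inner ℝ (w j) x • w j) = σ x

/-- Projection to the span of the forms leaves all of them unchanged. An orthonormal basis of the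
span is taken so that errors in the values of the forms become Euclidean errors with no conditioning
loss. -/
theorem exists_orthonormal_forms {n r : ℕ} {s : MvPolynomial (Fin n) ℝ}
    (h : DependsOnLinear r s) : ∃ m ≤ r, ∃ w : Fin m → EuclideanSpace ℝ (Fin n), Orthonormal ℝ w ∧
      ∀ x : EuclideanSpace ℝ (Fin n),
        MvPolynomial.eval (∑ j, inner ℝ (w j) x • w j).ofLp s = MvPolynomial.eval x.ofLp s := by
  obtain ⟨v, hv⟩ := h
  let V : Submodule ℝ (EuclideanSpace ℝ (Fin n)) :=
    Submodule.span ℝ (Set.range fun i => WithLp.toLp 2 (v i))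
  have hm : Module.finrank ℝ V ≤ r := by
    have := finrank_range_le_card (R := ℝ) (fun i => WithLp.toLp 2 (v i))
    rw [Fintype.card_fin] at this
    exact this
  let B := stdOrthonormalBasis ℝ V
  refine ⟨_, hm, fun j => (B j : EuclideanSpace ℝ (Fin n)),
    B.orthonormal.comp_linearIsometry V.subtypeₗᵢ, fun x => ?_⟩
  have e : ∑ j, inner ℝ (B j : EuclideanSpace ℝ (Fin n)) x • (B j : EuclideanSpace ℝ (Fin n)) =
      V.starProjection x := by
    simp [B.starProjection_eq_sum_rankOne]
  rw [e]
  refine hv _ _ fun i => ?_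
  have hmem : WithLp.toLp 2 (v i) ∈ V := Submodule.subset_span ⟨i, rfl⟩
  have h0 : inner ℝ (WithLp.toLp 2 (v i)) (x - V.starProjection x) = 0 :=
    Submodule.inner_right_of_mem_orthogonal hmem (Submodule.sub_starProjection_mem_orthogonal x)
  rw [inner_sub_right, sub_eq_zero] at h0
  simp only [PiLp.inner_apply] at h0
  simpa [mul_comm] using h0.symm

theorem exists_thresholdFn {n r : ℕ} (s : MvPolynomial (Fin n) ℝ) (hs : s.totalDegree ≤ 2)
    (hr : DependsOnLinear r s) {I : Set ℝ} (hI : I.OrdConnected) :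
    ∃ m ≤ r, ∃ (w : Fin m → EuclideanSpace ℝ (Fin n)) (σ : EuclideanSpace ℝ (Fin n) → ℝ)
      (E : Finset ℝ), ThresholdFn (indIn s I) w σ E := by
  classical
  obtain ⟨m, hm, w, hw, hproj⟩ := exists_orthonormal_forms hr
  obtain ⟨b, l, β, c, hdiag⟩ := exists_eval_eq_diagQuad s hs
  have hmeas : Measurable (indIn s I) := by
    refine measurable_const.indicator ?_
    exact (MvPolynomial.continuous_eval s).measurable hI.measurableSet
  have h01 : ∀ x, indIn s I x = 0 ∨ indIn s I x = 1 := by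
    intro x
    unfold indIn
    by_cases h : x ∈ {x | MvPolynomial.eval x s ∈ I}
    · right; rw [Set.indicator_of_mem h]
    · left; rw [Set.indicator_of_notMem h]
  have hind : ∀ x y : Fin n → ℝ, MvPolynomial.eval x s = MvPolynomial.eval y s →
      indIn s I x = indIn s I y := by
    intro x y h
    simp [indIn, Set.indicator_apply, h]
  -- A constant polynomial has a constant indicator: nothing can be crossed, and `E` is empty.
  by_cases hconst : ∀ i, max |l i| |β i| = 0
  · have h0 : ∀ i, l i = 0 ∧ β i = 0 := by
      intro i
      have h1 := le_max_left |l i| |β i|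
      have h2 := le_max_right |l i| |β i|
      rw [hconst i] at h1 h2
      exact ⟨abs_nonpos_iff.mp h1, abs_nonpos_iff.mp h2⟩
    refine ⟨m, hm, w, 0, ∅, ⟨hw, hmeas, h01, continuous_zero, by simp, ?_, ?_, by simp,
      fun x => hind _ _ (hproj x), by simp⟩⟩
    · intro x y hxy
      refine absurd (hind _ _ ?_) hxy
      rw [hdiag, hdiag]; simp [diagQuad, h0]
    · intro x y; simp; positivity
  · push Not at hconst
    obtain ⟨i₁, hi₁⟩ := hconst
    have : Nonempty (Fin n) := ⟨i₁⟩
    obtain ⟨i₀, hi₀⟩ := Finite.exists_max fun i => max |l i| |β i|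
    -- Division by the largest coefficient serves both sides: all coefficients are at most 1, as the
    -- Lipschitz bound needs, and one equals 1 in absolute value, as anticoncentration needs.
    set Λ := max |l i₀| |β i₀| with hΛ
    have hΛ0 : 0 < Λ := by
      refine lt_of_lt_of_le (lt_of_le_of_ne ?_ hi₁.symm) (hi₀ i₁)
      exact le_max_of_le_left (abs_nonneg _)
    have hscale : ∀ x, diagQuad b l β c x =
        Λ * diagQuad b (fun i => l i / Λ) (fun i => β i / Λ) 0 x + c := by
      intro x
      simp only [diagQuad, add_zero, Finset.mul_sum]
      congr 1
      refine Finset.sum_congr rfl fun i _ => ?_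
      field_simp
    set σ := diagQuad b (fun i => l i / Λ) (fun i => β i / Λ) 0 with hσ
    have hJ : {t : ℝ | Λ * t + c ∈ I}.OrdConnected := by
      constructor
      intro t ht u hu z hz
      refine hI.out ht hu ⟨?_, ?_⟩
      · have := hz.1; gcongr
      · have := hz.2; gcongr
    obtain ⟨E, hE, hcross⟩ := exists_endpoints_of_ordConnected hJ
    have hval : ∀ x : EuclideanSpace ℝ (Fin n), indIn s I x.ofLp =
        if σ x ∈ {t : ℝ | Λ * t + c ∈ I} then 1 else 0 := by
      intro x
      simp [indIn, Set.indicator_apply, hdiag, hscale]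
    refine ⟨m, hm, w, σ, E, ⟨hw, hmeas, h01, continuous_diagQuad _ _ _ _, hE, ?_, ?_, ?_,
      fun x => hind _ _ (hproj x), ?_⟩⟩
    · intro x y hxy
      rw [hval, hval] at hxy
      have key : ∃ e ∈ E, e ∈ Set.uIcc (σ x) (σ y) := by
        by_cases hx : σ x ∈ {t : ℝ | Λ * t + c ∈ I} <;>
          by_cases hy : σ y ∈ {t : ℝ | Λ * t + c ∈ I}
        · simp [hx, hy] at hxy
        · exact hcross _ hx _ hy
        · rw [Set.uIcc_comm]; exact hcross _ hy _ hx
        · simp [hx, hy] at hxy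
      obtain ⟨e, he, hmem⟩ := key
      refine ⟨e, he, ?_⟩
      have := Set.abs_sub_left_of_mem_uIcc hmem
      rwa [abs_sub_comm, abs_sub_comm (σ x)]
    · refine abs_diagQuad_sub_le b 0 (fun i => ?_) (fun i => ?_)
      · rw [abs_div, abs_of_pos hΛ0, div_le_one hΛ0]
        exact (le_max_left _ _).trans (hi₀ i)
      · rw [abs_div, abs_of_pos hΛ0, div_le_one hΛ0]
        exact (le_max_right _ _).trans (hi₀ i)
    · intro e _ η hη
      have := stdGauss_diagQuad_le b (fun i => l i / Λ) (fun i => β i / Λ) (-e) hη ⟨i₀, by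
        rw [abs_div, abs_div, abs_of_pos hΛ0, one_le_div hΛ0, one_le_div hΛ0]
        rcases le_total |l i₀| |β i₀| with h | h
        · right; rw [hΛ, max_eq_right h]
        · left; rw [hΛ, max_eq_left h]⟩
      refine le_trans (le_of_eq (congrArg _ ?_)) this
      ext x
      simp [hσ, diagQuad, sub_eq_add_neg]
    · intro x
      have h1 := hproj x
      rw [hdiag, hdiag, hscale, hscale] at h1
      have := add_right_cancel h1
      exact mul_left_cancel₀ hΛ0.ne' this

/-! ### Branching programs that add up contributions of the blocks -/

/-- The memory stores the encoding of a partial sum; a left inverse suffices because only encoded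
states are ever reached. -/
theorem Fin.foldl_add_conj {T α : Type*} [AddCommMonoid T] (e : T → α) (inv : α → T)
    (h : Function.LeftInverse inv e) {n : ℕ} (g : Fin n → T) :
    Fin.foldl n (fun m i => e (inv m + g i)) (e 0) = e (∑ i, g i) := by
  induction n with
  | zero => simp
  | succ n ih =>
    rw [Fin.foldl_succ_last, ih, h, Fin.sum_univ_castSucc]

theorem fools_set_of_additive_state {M S D n : ℕ} {ε : ℝ} {G : (Fin S → Bool) → Fin n → Fin D → Bool}
    (hG : FoolsROBP M ε G) {T : Type*} [AddCommMonoid T] [Fintype T] (hT : Fintype.card T ≤ 2 ^ M)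
    (f : Fin n → (Fin D → Bool) → T) (A : Set T) [DecidablePred (· ∈ A)] :
    |(𝔼 x : Fin n → Fin D → Bool, (if ∑ i, f i (x i) ∈ A then (1 : ℝ) else 0)) -
      (𝔼 z : Fin S → Bool, (if ∑ i, f i (G z i) ∈ A then (1 : ℝ) else 0))| ≤ ε := by
  obtain ⟨e⟩ : Nonempty (T ↪ (Fin M → Bool)) :=
    Function.Embedding.nonempty_of_card_le (by simpa using hT)
  have hinv := Function.leftInverse_invFun e.injective
  have h := hG ⟨e 0, fun i m u => e (Function.invFun e m + f i u),
    fun m => decide (Function.invFun e m ∈ A)⟩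
  have hc : ∀ x : Fin n → Fin D → Bool, (ROBP.compute ⟨e 0, fun i m u =>
      e (Function.invFun e m + f i u), fun m => decide (Function.invFun e m ∈ A)⟩ x = true) ↔
      ∑ i, f i (x i) ∈ A := by
    intro x
    simp only [ROBP.compute]
    rw [Fin.foldl_add_conj e _ hinv (fun i => f i (x i)), hinv, decide_eq_true_iff]
  simpa only [hc] using h

/-- Splitting by the sign of `D` passes from a bound on all events to an `ℓ¹` bound between laws. -/
theorem sum_abs_le_of_abs_sum_le {T : Type*} [Fintype T] {D : T → ℝ} {ε : ℝ}
    (h : ∀ A : Finset T, |∑ t ∈ A, D t| ≤ ε) : ∑ t, |D t| ≤ 2 * ε := by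
  classical
  rw [← Finset.sum_filter_add_sum_filter_not Finset.univ (fun t => 0 ≤ D t), two_mul]
  refine add_le_add ?_ ?_
  · refine le_trans (le_trans (le_of_eq (Finset.sum_congr rfl fun t ht => ?_)) (le_abs_self _)) (h _)
    exact abs_of_nonneg (Finset.mem_filter.mp ht).2
  · refine le_trans (le_trans (le_of_eq ?_) (neg_le_abs _))
      (h (Finset.univ.filter fun t => ¬ 0 ≤ D t))
    rw [← Finset.sum_neg_distrib]
    refine Finset.sum_congr rfl fun t ht => ?_
    exact abs_of_neg (not_le.mp (Finset.mem_filter.mp ht).2)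

theorem expect_comp_eq_sum {α T : Type*} [Fintype α] [Fintype T] [DecidableEq T] (st : α → T)
    (F : T → ℝ) (A : Finset T) :
    (𝔼 x, if st x ∈ A then F (st x) else 0) = ∑ t ∈ A, F t * 𝔼 x, (if st x = t then (1 : ℝ) else 0) := by
  simp_rw [Finset.mul_expect]
  rw [← Finset.expect_sum_comm]
  refine Finset.expect_congr rfl fun x _ => ?_
  simp

theorem abs_expect_additive_state_sub_le {M S D n : ℕ} {ε : ℝ}
    {G : (Fin S → Bool) → Fin n → Fin D → Bool} (hG : FoolsROBP M ε G) {T : Type*}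
    [AddCommMonoid T] [Fintype T] (hT : Fintype.card T ≤ 2 ^ M)
    (f : Fin n → (Fin D → Bool) → T) (F : T → ℝ) {B : ℝ}
    (hF : ∀ x : Fin n → Fin D → Bool, |F (∑ i, f i (x i))| ≤ B) :
    |(𝔼 x : Fin n → Fin D → Bool, F (∑ i, f i (x i))) -
      (𝔼 z : Fin S → Bool, F (∑ i, f i (G z i)))| ≤ 2 * B * ε := by
  classical
  set p : T → ℝ := fun t => 𝔼 x : Fin n → Fin D → Bool, if ∑ i, f i (x i) = t then (1 : ℝ) else 0
  set p' : T → ℝ := fun t => 𝔼 z : Fin S → Bool, if ∑ i, f i (G z i) = t then (1 : ℝ) else 0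
  have hB : 0 ≤ B := (abs_nonneg _).trans (hF fun _ _ => false)
  have e1 := expect_comp_eq_sum (fun x : Fin n → Fin D → Bool => ∑ i, f i (x i)) F Finset.univ
  have e2 := expect_comp_eq_sum (fun z : Fin S → Bool => ∑ i, f i (G z i)) F Finset.univ
  simp only [Finset.mem_univ, if_true] at e1 e2
  have hD : ∀ A : Finset T, |∑ t ∈ A, (p t - p' t)| ≤ ε := by
    intro A
    have h := fools_set_of_additive_state hG hT f (A : Set T)
    have a1 := expect_comp_eq_sum (fun x : Fin n → Fin D → Bool => ∑ i, f i (x i)) (fun _ => 1) A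
    have a2 := expect_comp_eq_sum (fun z : Fin S → Bool => ∑ i, f i (G z i)) (fun _ => 1) A
    simp only [one_mul] at a1 a2
    simp only [Finset.mem_coe] at h
    rw [a1, a2, ← Finset.sum_sub_distrib] at h
    exact h
  rw [e1, e2, ← Finset.sum_sub_distrib]
  calc |∑ t, (F t * p t - F t * p' t)| ≤ ∑ t, |F t * p t - F t * p' t| :=
        Finset.abs_sum_le_sum_abs _ _
    _ ≤ ∑ t, B * |p t - p' t| := by
        refine Finset.sum_le_sum fun t _ => ?_
        rw [← mul_sub, abs_mul]
        -- Unreachable states have mass zero in both laws, so `F` needs a bound only on reachable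
        -- ones.
        by_cases ht : ∃ x : Fin n → Fin D → Bool, ∑ i, f i (x i) = t
        · obtain ⟨x, rfl⟩ := ht
          exact mul_le_mul_of_nonneg_right (hF x) (abs_nonneg _)
        · have hp : p t = 0 := Finset.expect_eq_zero fun x _ => if_neg fun h => ht ⟨x, h⟩
          have hp' : p' t = 0 := Finset.expect_eq_zero fun z _ => if_neg fun h => ht ⟨G z, h⟩
          simp [hp, hp']
    _ = B * ∑ t, |p t - p' t| := by rw [Finset.mul_sum]
    _ ≤ B * (2 * ε) := mul_le_mul_of_nonneg_left (sum_abs_le_of_abs_sum_le hD) hB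
    _ = _ := by ring

/-- Each contribution is rounded to an integer multiple of `τ`, and the multiples are added modulo
`N`, one residue per form. Hence the final state is a sum over the blocks in a finite group. -/
theorem exists_fooled_approx_linear_forms {M S D n : ℕ} {ι : Type*} [Fintype ι] {ε : ℝ}
    {G : (Fin S → Bool) → Fin n → Fin D → Bool} (hG : FoolsROBP M ε G)
    {φ : Fin n → (Fin D → Bool) → ℝ} {L : ℝ} (hφ : ∀ i u, |φ i u| ≤ L)
    {v : ι → Fin n → ℝ} (hv : ∀ j i, |v j i| ≤ 1) {τ : ℝ} (hτ : 0 < τ) {N : ℕ}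
    (hN : 2 * (n * (L / τ + 1)) < N) (hk : N ^ Fintype.card ι ≤ 2 ^ M) :
    ∃ ap : (Fin n → Fin D → Bool) → ι → ℝ,
      (∀ x j, |ap x j - ∑ i, v j i * φ i (x i)| ≤ n * τ) ∧
      ∀ (F : (ι → ℝ) → ℝ) (B : ℝ), (∀ x, |F (ap x)| ≤ B) →
        |(𝔼 x : Fin n → Fin D → Bool, F (ap x)) - (𝔼 z : Fin S → Bool, F (ap (G z)))| ≤
          2 * B * ε := by
  classical
  rcases Nat.eq_zero_or_pos n with rfl | hn
  · refine ⟨fun _ _ => 0, fun x j => by simp, fun F B hF => ?_⟩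
    have hε : 0 ≤ ε := (abs_nonneg _).trans (hG ⟨fun _ => false, fun _ m _ => m, fun _ => false⟩)
    have hB := (abs_nonneg _).trans (hF fun _ _ => false)
    simp; positivity
  have hL : 0 ≤ L := (abs_nonneg _).trans (hφ ⟨0, hn⟩ fun _ => false)
  have hN0 : 0 < N := by
    have : (0 : ℝ) < N := lt_of_le_of_lt (by positivity) hN
    exact_mod_cast this
  have : NeZero N := ⟨hN0.ne'⟩
  let c : Fin n → (Fin D → Bool) → ι → ℤ := fun i u j => round (v j i * φ i u / τ)
  let f : Fin n → (Fin D → Bool) → ι → ZMod N := fun i u j => (c i u j : ZMod N)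
  let dec : (ι → ZMod N) → ι → ℝ := fun t j => τ * ((t j).valMinAbs : ℤ)
  have hround : ∀ i u j, |v j i * φ i u / τ - c i u j| ≤ 1 / 2 := fun i u j => abs_sub_round _
  have hcb : ∀ i u j, |(c i u j : ℝ)| ≤ L / τ + 1 := by
    intro i u j
    have h1 := hround i u j
    have h2 : |v j i * φ i u / τ| ≤ L / τ := by
      rw [abs_div, abs_of_pos hτ, abs_mul]
      gcongr
      calc _ ≤ 1 * L := mul_le_mul (hv j i) (hφ i u) (abs_nonneg _) zero_le_one
        _ = L := one_mul L
    have h3 := abs_sub_abs_le_abs_sub (c i u j : ℝ) (v j i * φ i u / τ)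
    rw [abs_sub_comm] at h3
    linarith
  -- The integer sum is below `N/2` in absolute value, so there is no wrap-around and its residue of
  -- least absolute value recovers it.
  have hdec : ∀ (x : Fin n → Fin D → Bool) j, dec (∑ i, f i (x i)) j = τ * ∑ i, (c i (x i) j : ℝ) := by
    intro x j
    have h1 : (∑ i, f i (x i)) j = ((∑ i, c i (x i) j : ℤ) : ZMod N) := by
      simp [f]
    have h2 : |((∑ i, c i (x i) j : ℤ) : ℝ)| ≤ n * (L / τ + 1) := by
      push_cast
      refine (Finset.abs_sum_le_sum_abs _ _).trans
        ((Finset.sum_le_sum fun i _ => hcb i (x i) j).trans ?_)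
      rw [Finset.sum_const, Finset.card_univ, Fintype.card_fin, nsmul_eq_mul]
    have h3 : ((∑ i, c i (x i) j : ℤ) : ZMod N).valMinAbs = ∑ i, c i (x i) j := by
      rw [ZMod.valMinAbs_spec]
      refine ⟨rfl, ?_⟩
      have h4 := abs_le.mp h2
      constructor
      · have : (-(N : ℝ)) < ((∑ i, c i (x i) j : ℤ) : ℝ) * 2 := by linarith [h4.1]
        exact_mod_cast this
      · have : ((∑ i, c i (x i) j : ℤ) : ℝ) * 2 ≤ N := by linarith [h4.2]
        exact_mod_cast this
    simp only [dec, h1, h3]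
    push_cast
    rfl
  refine ⟨fun x => dec (∑ i, f i (x i)), fun x j => ?_, fun F B hF => ?_⟩
  · simp only [hdec]
    rw [Finset.mul_sum, ← Finset.sum_sub_distrib]
    refine (Finset.abs_sum_le_sum_abs _ _).trans
      ((Finset.sum_le_sum fun i _ => (?_ : _ ≤ τ)).trans (by simp))
    have h1 := hround i (x i) j
    have e : τ * (c i (x i) j : ℝ) - v j i * φ i (x i) =
        -(τ * (v j i * φ i (x i) / τ - c i (x i) j)) := by field_simp; ring
    rw [e, abs_neg, abs_mul, abs_of_pos hτ]
    nlinarith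
  · exact abs_expect_additive_state_sub_le hG (by simpa [ZMod.card] using hk) f (fun t => F (dec t)) hF

/-! ### Coupling with independent approximate Gaussians -/

instance isProbabilityMeasure_blockLaw {D : ℕ} (φ : (Fin D → Bool) → ℝ) :
    IsProbabilityMeasure (blockLaw φ) := by
  unfold blockLaw; infer_instance

/-- Every value `φ u` is an atom of positive mass, so the almost sure bound holds everywhere, in
particular at the outputs of the generator. -/
theorem abs_le_of_ae_blockLaw {D : ℕ} {φ : (Fin D → Bool) → ℝ} {L : ℝ}
    (h : ∀ᵐ y ∂(blockLaw φ), |y| ≤ L) (u : Fin D → Bool) : |φ u| ≤ L := by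
  by_contra hu
  have h0 : blockLaw φ {y | ¬ |y| ≤ L} = 0 := h
  have h1 : blockLaw φ {φ u} = 0 :=
    measure_mono_null (Set.singleton_subset_iff.mpr hu) h0
  rw [blockLaw, PMF.toMeasure_apply_singleton _ _ (measurableSet_singleton _)] at h1
  have h2 : φ u ∈ ((PMF.uniformOfFintype (Fin D → Bool)).map φ).support := by
    rw [PMF.mem_support_map_iff]
    exact ⟨u, by simp, rfl⟩
  exact h2 h1

theorem integral_pi_blockLaw {D n : ℕ} (φ : Fin n → (Fin D → Bool) → ℝ) {F : (Fin n → ℝ) → ℝ}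
    (hF : Measurable F) :
    ∫ y, F y ∂(Measure.pi fun i => blockLaw (φ i)) =
      𝔼 x : Fin n → Fin D → Bool, F (fun i => φ i (x i)) := by
  set μ : Measure (Fin D → Bool) := (PMF.uniformOfFintype (Fin D → Bool)).toMeasure with hμ
  have e1 : ∀ i, blockLaw (φ i) = μ.map (φ i) := fun i =>
    (PMF.toMeasure_map (φ i) _ (measurable_of_finite _)).symm
  have e2 : (Measure.pi fun i => blockLaw (φ i)) =
      (Measure.pi fun _ : Fin n => μ).map (fun x i => φ i (x i)) := by
    simp_rw [e1]
    have : ∀ i, SigmaFinite (μ.map (φ i)) := fun i => by rw [← e1]; infer_instance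
    exact (Measure.pi_map_pi fun i => (measurable_of_finite _).aemeasurable).symm
  rw [e2, integral_map (measurable_of_finite _).aemeasurable hF.aestronglyMeasurable,
    integral_fintype (Integrable.of_finite), Finset.expect_eq_sum_div_card, Finset.sum_div]
  refine Finset.sum_congr rfl fun x _ => ?_
  have hx : (Measure.pi fun _ : Fin n => μ).real {x} =
      (Fintype.card (Fin n → Fin D → Bool) : ℝ)⁻¹ := by
    rw [measureReal_def, Measure.pi_singleton]
    have : ∀ i, μ {x i} = (Fintype.card (Fin D → Bool) : ENNReal)⁻¹ := fun i => by
      rw [hμ, PMF.toMeasure_apply_singleton _ _ (measurableSet_singleton _)]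
      simp
    simp [this]
  rw [hx, smul_eq_mul, Finset.card_univ, inv_mul_eq_div]

/-- A coupling of the standard Gaussian on `ℝⁿ` with the independent family `φᵢ(uᵢ)`. -/
structure BlockCoupling {D n : ℕ} (φ : Fin n → (Fin D → Bool) → ℝ) (δ L : ℝ)
    (ρ : Measure ((Fin n → ℝ) × (Fin n → ℝ))) : Prop where
  isProb : IsProbabilityMeasure ρ
  fst : ρ.map Prod.fst = stdGauss n
  snd : ρ.map Prod.snd = Measure.pi fun i => blockLaw (φ i)
  far_le : ρ.real {p | ∃ i, δ < |p.1 i - p.2 i|} ≤ n * δ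
  bounded : ∀ᵐ p ∂ρ, ∀ i, |p.2 i| ≤ L

theorem exists_blockCoupling {D n : ℕ} {φ : Fin n → (Fin D → Bool) → ℝ} {K δ : ℝ} (hδ : 0 ≤ δ)
    (h : ∀ i, IsApproxGaussian K δ (blockLaw (φ i))) :
    ∃ ρ, BlockCoupling φ δ (K * Real.log (1 / δ)) ρ := by
  choose π hfst hsnd hfar using fun i => (h i).1
  have hprob : ∀ i, IsProbabilityMeasure (π i) := fun i => by
    constructor
    have := congrArg (fun μ => μ Set.univ) (hfst i)
    simpa [Measure.fst_univ] using this
  have m1 : Measurable fun p : Fin n → ℝ × ℝ => fun i => (p i).1 := by fun_prop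
  have m2 : Measurable fun p : Fin n → ℝ × ℝ => fun i => (p i).2 := by fun_prop
  have m3 := m1.prodMk m2
  have i1 : ∀ i, SigmaFinite ((π i).map Prod.fst) := fun i => by
    have := hfst i
    rw [Measure.fst] at this
    rw [this]; infer_instance
  have i2 : ∀ i, SigmaFinite ((π i).map Prod.snd) := fun i => by
    have := hsnd i
    rw [Measure.snd] at this
    rw [this]; infer_instance
  have hf1 : (Measure.pi π).map (fun p i => (p i).1) = stdGauss n := by
    rw [Measure.pi_map_pi (f := fun _ => Prod.fst) fun i => measurable_fst.aemeasurable, stdGauss]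
    congr 1; ext1 i; exact hfst i
  have hf2 : (Measure.pi π).map (fun p i => (p i).2) = Measure.pi fun i => blockLaw (φ i) := by
    rw [Measure.pi_map_pi (f := fun _ => Prod.snd) fun i => measurable_snd.aemeasurable]
    congr 1; ext1 i; exact hsnd i
  -- The product of the coordinate couplings, with pairs regrouped; the far event is then a union
  -- bound.
  refine ⟨(Measure.pi π).map fun p => (fun i => (p i).1, fun i => (p i).2),
    Measure.isProbabilityMeasure_map m3.aemeasurable, ?_, ?_, ?_, ?_⟩
  · rw [Measure.map_map measurable_fst m3]; exact hf1
  · rw [Measure.map_map measurable_snd m3]; exact hf2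
  · have hms : MeasurableSet {p : (Fin n → ℝ) × (Fin n → ℝ) | ∃ i, δ < |p.1 i - p.2 i|} := by
      have : {p : (Fin n → ℝ) × (Fin n → ℝ) | ∃ i, δ < |p.1 i - p.2 i|} =
          ⋃ i, {p | δ < |p.1 i - p.2 i|} := by ext; simp
      rw [this]
      exact MeasurableSet.iUnion fun i => measurableSet_lt measurable_const (by fun_prop)
    rw [measureReal_def, Measure.map_apply m3 hms]
    refine ENNReal.toReal_le_of_le_ofReal (by positivity) ?_
    have hsub : (fun p : Fin n → ℝ × ℝ => ((fun i => (p i).1, fun i => (p i).2) :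
        (Fin n → ℝ) × (Fin n → ℝ))) ⁻¹' {p | ∃ i, δ < |p.1 i - p.2 i|} ⊆
        ⋃ i, (Function.eval i) ⁻¹' {p : ℝ × ℝ | δ < |p.1 - p.2|} := by
      intro p hp
      obtain ⟨i, hi⟩ := hp
      exact Set.mem_iUnion.mpr ⟨i, hi⟩
    refine (measure_mono hsub).trans ((measure_iUnion_fintype_le _ _).trans ?_)
    have hb : ∀ i, Measure.pi π ((Function.eval i) ⁻¹' {p : ℝ × ℝ | δ < |p.1 - p.2|}) ≤
        ENNReal.ofReal δ := by
      intro i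
      have hm : MeasurableSet {p : ℝ × ℝ | δ < |p.1 - p.2|} :=
        measurableSet_lt measurable_const (by fun_prop)
      rw [(measurePreserving_eval π i).measure_preimage hm.nullMeasurableSet]
      exact (hfar i).le
    refine (Finset.sum_le_sum fun i _ => hb i).trans ?_
    rw [Finset.sum_const, Finset.card_univ, Fintype.card_fin, nsmul_eq_mul,
      ENNReal.ofReal_mul (by positivity), ENNReal.ofReal_natCast]
  · rw [ae_all_iff]
    intro i
    rw [ae_map_iff m3.aemeasurable (measurableSet_le (by fun_prop) measurable_const)]
    have h2 := (h i).2
    rw [← hsnd i, Measure.snd, ae_map_iff measurable_snd.aemeasurable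
      (measurableSet_le (by fun_prop) measurable_const)] at h2
    exact (measurePreserving_eval π i).quasiMeasurePreserving.ae h2

/-- Cauchy-Schwarz against an indicator: how a rare event is charged when `q(X)` has no pointwise
bound. -/
theorem integral_indicator_abs_le_sqrt {α : Type*} [MeasurableSpace α] {μ : Measure α}
    [IsProbabilityMeasure μ] {f : α → ℝ} (hf : MemLp f 2 μ) {B : Set α} (hB : MeasurableSet B) :
    ∫ x, B.indicator (fun x => |f x|) x ∂μ ≤ √(μ.real B) * √(∫ x, f x ^ 2 ∂μ) := by
  have h1 : MemLp (fun x => |f x|) (ENNReal.ofReal 2) μ := by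
    rw [ENNReal.ofReal_ofNat]; exact hf.abs
  have h2 : MemLp (B.indicator fun _ => (1 : ℝ)) (ENNReal.ofReal 2) μ :=
    (memLp_const 1).indicator hB
  have h := integral_mul_le_Lp_mul_Lq_of_nonneg Real.HolderConjugate.two_two
    (ae_of_all μ fun x => Set.indicator_nonneg (fun _ _ => zero_le_one) x)
    (ae_of_all μ fun x => abs_nonneg (f x)) h2 h1
  have e1 : ∀ x, B.indicator (fun _ => (1 : ℝ)) x * |f x| = B.indicator (fun x => |f x|) x := by
    intro x; by_cases hx : x ∈ B <;> simp [hx]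
  have e2 : ∀ x, B.indicator (fun _ => (1 : ℝ)) x ^ (2 : ℝ) = B.indicator (fun _ => (1 : ℝ)) x := by
    intro x; by_cases hx : x ∈ B <;> simp [hx]
  have e3 : ∀ x, |f x| ^ (2 : ℝ) = f x ^ 2 := by
    intro x; rw [Real.rpow_two, sq_abs]
  simp_rw [e1, e2, e3] at h
  rw [integral_indicator_const _ hB] at h
  simpa [Real.sqrt_eq_rpow] using h

/-! ### Comparison of the Gaussian with the independent blocks -/

theorem EuclideanSpace.norm_le_sqrt_mul {n : ℕ} {x : EuclideanSpace ℝ (Fin n)} {B : ℝ} (hB : 0 ≤ B)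
    (h : ∀ i, |x i| ≤ B) : ‖x‖ ≤ √n * B := by
  rw [EuclideanSpace.norm_eq, ← Real.sqrt_sq hB, ← Real.sqrt_mul (by positivity)]
  refine Real.sqrt_le_sqrt ?_
  calc ∑ i, ‖x i‖ ^ 2 ≤ ∑ _i : Fin n, B ^ 2 := by
        refine Finset.sum_le_sum fun i _ => ?_
        rw [Real.norm_eq_abs]
        exact pow_le_pow_left₀ (abs_nonneg _) (h i) 2
    _ = _ := by simp

theorem ThresholdFn.scale_sub_le {n m : ℕ} {g : (Fin n → ℝ) → ℝ}
    {w : Fin m → EuclideanSpace ℝ (Fin n)} {σ : EuclideanSpace ℝ (Fin n) → ℝ} {E : Finset ℝ}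
    (T : ThresholdFn g w σ E) {x y : EuclideanSpace ℝ (Fin n)} {δ L : ℝ} (hδ0 : 0 ≤ δ)
    (hδ : δ ≤ 1) (hxy : ‖x - y‖ ≤ √n * δ) (hy : ‖y‖ ≤ √n * L) :
    |σ x - σ y| ≤ n * δ * (2 * L + 2) := by
  have hx : ‖x‖ ≤ √n * (L + δ) := by
    calc ‖x‖ = ‖(x - y) + y‖ := by rw [sub_add_cancel]
      _ ≤ ‖x - y‖ + ‖y‖ := norm_add_le _ _
      _ ≤ _ := by linarith
  have hn : (0 : ℝ) ≤ √n := Real.sqrt_nonneg _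
  have hx' : √n * (L + δ) ≤ √n * (L + 1) := by gcongr
  calc |σ x - σ y| ≤ ‖x - y‖ * (‖x‖ + ‖y‖ + √n) := T.lipschitz x y
    _ ≤ (√n * δ) * (√n * (L + 1) + √n * L + √n) := by
        gcongr; exact hx.trans hx'
    _ = (√n * √n) * δ * (2 * L + 2) := by ring
    _ = _ := by rw [Real.mul_self_sqrt (by positivity)]

theorem ThresholdFn.scale_sub_le_of_coord {n m : ℕ} {g : (Fin n → ℝ) → ℝ}
    {w : Fin m → EuclideanSpace ℝ (Fin n)} {σ : EuclideanSpace ℝ (Fin n) → ℝ} {E : Finset ℝ}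
    (T : ThresholdFn g w σ E) {x y : Fin n → ℝ} {δ L : ℝ} (hL : 0 ≤ L) (hδ0 : 0 ≤ δ)
    (hδ : δ ≤ 1) (hxy : ∀ i, |x i - y i| ≤ δ) (hy : ∀ i, |y i| ≤ L) :
    |σ (WithLp.toLp 2 x) - σ (WithLp.toLp 2 y)| ≤ n * δ * (2 * L + 2) :=
  T.scale_sub_le hδ0 hδ (EuclideanSpace.norm_le_sqrt_mul hδ0 (by simpa using hxy))
    (EuclideanSpace.norm_le_sqrt_mul hL (by simpa using hy))

theorem measurableSet_near {n : ℕ} {σ : EuclideanSpace ℝ (Fin n) → ℝ} (hσ : Continuous σ)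
    (e η : ℝ) : MeasurableSet {x : Fin n → ℝ | |σ (WithLp.toLp 2 x) - e| ≤ η} :=
  measurableSet_le (by fun_prop) measurable_const

theorem measurableSet_far {n : ℕ} (δ : ℝ) :
    MeasurableSet {p : (Fin n → ℝ) × (Fin n → ℝ) | ∃ i, δ < |p.1 i - p.2 i|} := by
  have : {p : (Fin n → ℝ) × (Fin n → ℝ) | ∃ i, δ < |p.1 i - p.2 i|} =
      ⋃ i, {p | δ < |p.1 i - p.2 i|} := by ext; simp
  rw [this]
  exact MeasurableSet.iUnion fun i => measurableSet_lt measurable_const (by fun_prop)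

theorem BlockCoupling.measurePreserving_fst {D n : ℕ} {φ : Fin n → (Fin D → Bool) → ℝ} {δ L : ℝ}
    {ρ : Measure ((Fin n → ℝ) × (Fin n → ℝ))} (h : BlockCoupling φ δ L ρ) :
    MeasurePreserving Prod.fst ρ (stdGauss n) := ⟨measurable_fst, h.fst⟩

theorem BlockCoupling.integral_snd {D n : ℕ} {φ : Fin n → (Fin D → Bool) → ℝ} {δ L : ℝ}
    {ρ : Measure ((Fin n → ℝ) × (Fin n → ℝ))} (h : BlockCoupling φ δ L ρ) {F : (Fin n → ℝ) → ℝ}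
    (hF : Measurable F) :
    ∫ p, F p.2 ∂ρ = 𝔼 x : Fin n → Fin D → Bool, F (fun i => φ i (x i)) := by
  rw [← integral_pi_blockLaw φ hF, ← h.snd,
    integral_map measurable_snd.aemeasurable hF.aestronglyMeasurable]

theorem BlockCoupling.integral_fst {D n : ℕ} {φ : Fin n → (Fin D → Bool) → ℝ} {δ L : ℝ}
    {ρ : Measure ((Fin n → ℝ) × (Fin n → ℝ))} (h : BlockCoupling φ δ L ρ) {F : (Fin n → ℝ) → ℝ}
    (hF : Measurable F) : ∫ p, F p.1 ∂ρ = ∫ x, F x ∂(stdGauss n) := by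
  rw [← h.fst, integral_map measurable_fst.aemeasurable hF.aestronglyMeasurable]

theorem BlockCoupling.near_fst_le {D n m : ℕ} {φ : Fin n → (Fin D → Bool) → ℝ} {δ L : ℝ}
    {ρ : Measure ((Fin n → ℝ) × (Fin n → ℝ))} (h : BlockCoupling φ δ L ρ) {g : (Fin n → ℝ) → ℝ}
    {w : Fin m → EuclideanSpace ℝ (Fin n)} {σ : EuclideanSpace ℝ (Fin n) → ℝ} {E : Finset ℝ}
    (T : ThresholdFn g w σ E) {e : ℝ} (he : e ∈ E) {η : ℝ} (hη : 0 ≤ η) :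
    ρ.real {p | |σ (WithLp.toLp 2 p.1) - e| ≤ η} ≤ 10 * √η := by
  rw [measureReal_def]
  refine ENNReal.toReal_le_of_le_ofReal (by positivity) ?_
  have := h.measurePreserving_fst.measure_preimage
    (measurableSet_near T.continuous e η).nullMeasurableSet
  exact this.le.trans (T.anticoncentration e he η hη)

/-- Anticoncentration passes from the Gaussian to the blocks: the window widens by the most that `σ`
can move under the coupling, and the far event adds `nδ`. -/
theorem BlockCoupling.expect_near_le {D n m : ℕ} {φ : Fin n → (Fin D → Bool) → ℝ} {δ L : ℝ}
    {ρ : Measure ((Fin n → ℝ) × (Fin n → ℝ))} (h : BlockCoupling φ δ L ρ) {g : (Fin n → ℝ) → ℝ}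
    {w : Fin m → EuclideanSpace ℝ (Fin n)} {σ : EuclideanSpace ℝ (Fin n) → ℝ} {E : Finset ℝ}
    (T : ThresholdFn g w σ E) (hL : 0 ≤ L) (hδ0 : 0 ≤ δ) (hδ : δ ≤ 1) {e : ℝ} (he : e ∈ E) {η : ℝ}
    (hη : 0 ≤ η) :
    (𝔼 x : Fin n → Fin D → Bool,
      if |σ (WithLp.toLp 2 fun i => φ i (x i)) - e| ≤ η then (1 : ℝ) else 0) ≤
      10 * √(η + n * δ * (2 * L + 2)) + n * δ := by
  have := h.isProb
  set η₀ := n * δ * (2 * L + 2) with hη₀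
  have hη₀' : 0 ≤ η₀ := by positivity
  set N := {y : Fin n → ℝ | |σ (WithLp.toLp 2 y) - e| ≤ η}
  have hN : MeasurableSet N := measurableSet_near T.continuous e η
  have e1 := h.integral_snd (F := N.indicator fun _ => (1 : ℝ)) (measurable_const.indicator hN)
  have e2 : (𝔼 x : Fin n → Fin D → Bool,
      if |σ (WithLp.toLp 2 fun i => φ i (x i)) - e| ≤ η then (1 : ℝ) else 0) =
      ρ.real (Prod.snd ⁻¹' N) := by
    have e3 : ∫ p, N.indicator (fun _ => (1 : ℝ)) p.2 ∂ρ = ρ.real (Prod.snd ⁻¹' N) := by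
      have : (fun p : (Fin n → ℝ) × (Fin n → ℝ) => N.indicator (fun _ => (1 : ℝ)) p.2) =
          (Prod.snd ⁻¹' N).indicator fun _ => (1 : ℝ) := rfl
      rw [this, integral_indicator_const _ (measurable_snd hN), smul_eq_mul, mul_one]
    rw [← e3, e1]
    refine Finset.expect_congr rfl fun x _ => ?_
    simp [N, Set.indicator_apply]
  rw [e2]
  have hnull : ρ.real {p | ¬ ∀ i, |p.2 i| ≤ L} = 0 := by
    rw [measureReal_def, show ρ {p | ¬ ∀ i, |p.2 i| ≤ L} = 0 from h.bounded]; rfl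
  have hsub : Prod.snd ⁻¹' N ⊆ ({p | |σ (WithLp.toLp 2 p.1) - e| ≤ η + η₀} ∪
      {p | ∃ i, δ < |p.1 i - p.2 i|}) ∪ {p | ¬ ∀ i, |p.2 i| ≤ L} := by
    intro p hp
    by_cases h1 : ∀ i, |p.2 i| ≤ L
    · by_cases h2 : ∃ i, δ < |p.1 i - p.2 i|
      · exact Or.inl (Or.inr h2)
      · push Not at h2
        refine Or.inl (Or.inl ?_)
        have h3 := T.scale_sub_le_of_coord hL hδ0 hδ h2 h1
        have h4 : |σ (WithLp.toLp 2 p.2) - e| ≤ η := hp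
        have h5 := abs_sub_le (σ (WithLp.toLp 2 p.1)) (σ (WithLp.toLp 2 p.2)) e
        exact h5.trans (by linarith)
    · exact Or.inr h1
  refine (measureReal_mono hsub).trans ((measureReal_union_le _ _).trans ?_)
  rw [hnull, add_zero]
  exact (measureReal_union_le _ _).trans
    (add_le_add (h.near_fst_le T he (by positivity)) h.far_le)

theorem ThresholdFn.abs_le_one {n m : ℕ} {g : (Fin n → ℝ) → ℝ}
    {w : Fin m → EuclideanSpace ℝ (Fin n)} {σ : EuclideanSpace ℝ (Fin n) → ℝ} {E : Finset ℝ}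
    (T : ThresholdFn g w σ E) (x : Fin n → ℝ) : |g x| ≤ 1 := by
  rcases T.zero_or_one x with h | h <;> simp [h]

theorem ThresholdFn.abs_sub_le_one {n m : ℕ} {g : (Fin n → ℝ) → ℝ}
    {w : Fin m → EuclideanSpace ℝ (Fin n)} {σ : EuclideanSpace ℝ (Fin n) → ℝ} {E : Finset ℝ}
    (T : ThresholdFn g w σ E) (x y : Fin n → ℝ) : |g x - g y| ≤ 1 := by
  rcases T.zero_or_one x with h | h <;> rcases T.zero_or_one y with h' | h' <;> simp [h, h']

/-- A coordinatewise bound for the change of `g` by the indicators of the boundary events. -/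
theorem ThresholdFn.abs_sub_le_sum_near {n m : ℕ} {g : (Fin n → ℝ) → ℝ}
    {w : Fin m → EuclideanSpace ℝ (Fin n)} {σ : EuclideanSpace ℝ (Fin n) → ℝ} {E : Finset ℝ}
    (T : ThresholdFn g w σ E) {x y : EuclideanSpace ℝ (Fin n)} {η : ℝ}
    (h : |σ x - σ y| ≤ η) :
    |g x.ofLp - g y.ofLp| ≤ ∑ e ∈ E, if |σ x - e| ≤ η then (1 : ℝ) else 0 := by
  have h0 : ∀ e ∈ E, (0 : ℝ) ≤ if |σ x - e| ≤ η then (1 : ℝ) else 0 := by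
    intro e _; split_ifs <;> norm_num
  by_cases hg : g x.ofLp = g y.ofLp
  · rw [hg, sub_self, abs_zero]
    exact Finset.sum_nonneg h0
  · obtain ⟨e, he, hle⟩ := T.crossing x y hg
    refine le_trans (T.abs_sub_le_one _ _) ((le_of_eq ?_).trans (Finset.single_le_sum h0 he))
    rw [if_pos (hle.trans h)]

/-- Three losses: the movement of `q` under a shift by `δ`; the far event, where `q(Y)` has the
bound `W` and `q(X)` is charged in `L²`; and the boundary events of the at most two levels. -/
theorem BlockCoupling.abs_integral_sub_expect_le {D n m d : ℕ} {φ : Fin n → (Fin D → Bool) → ℝ}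
    {δ L : ℝ} {ρ : Measure ((Fin n → ℝ) × (Fin n → ℝ))} (h : BlockCoupling φ δ L ρ)
    {g : (Fin n → ℝ) → ℝ} {w : Fin m → EuclideanSpace ℝ (Fin n)}
    {σ : EuclideanSpace ℝ (Fin n) → ℝ} {E : Finset ℝ} (T : ThresholdFn g w σ E) (hL : 0 ≤ L)
    (hδ0 : 0 ≤ δ) (hδ : δ ≤ 1) (q : MvPolynomial (Fin n) ℝ) {c : (Fin n → ℕ) → ℝ}
    (hc : ∀ x, MvPolynomial.eval x q = ∑ a ∈ multiIndexLE n d, c a * hermiteProd a x) :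
    |(∫ x, g x * MvPolynomial.eval x q ∂(stdGauss n)) -
      (𝔼 x : Fin n → Fin D → Bool, g (fun i => φ i (x i)) *
        MvPolynomial.eval (fun i => φ i (x i)) q)| ≤
      (∑ a ∈ multiIndexLE n d, |c a|) * (L + 3) ^ d * (δ * d + n * δ) +
        √(n * δ) * gaussL2 q + 2 * (√(10 * √(n * δ * (2 * L + 2))) * gaussL2 q) := by
  have := h.isProb
  set η₀ := n * δ * (2 * L + 2) with hη₀
  have hη₀' : 0 ≤ η₀ := by positivity
  set Q : (Fin n → ℝ) → ℝ := fun x => MvPolynomial.eval x q with hQ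
  set Cs := ∑ a ∈ multiIndexLE n d, |c a| with hCs
  have hCs0 : 0 ≤ Cs := Finset.sum_nonneg fun _ _ => abs_nonneg _
  have hQc : Continuous Q := MvPolynomial.continuous_eval q
  have hQ2 : MemLp (fun p : (Fin n → ℝ) × (Fin n → ℝ) => Q p.1) 2 ρ :=
    (memLp_two_eval q).comp_measurePreserving h.measurePreserving_fst
  have hQi : Integrable (fun p : (Fin n → ℝ) × (Fin n → ℝ) => Q p.1) ρ :=
    hQ2.integrable one_le_two
  have hQn : √(∫ p, Q p.1 ^ 2 ∂ρ) = gaussL2 q := by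
    rw [gaussL2, ← h.integral_fst (F := fun x => Q x ^ 2) (hQc.pow 2).measurable]
  have hgm := T.measurable
  have e1 : ∫ x, g x * Q x ∂(stdGauss n) = ∫ p, g p.1 * Q p.1 ∂ρ :=
    (h.integral_fst (F := fun x => g x * Q x) (hgm.mul hQc.measurable)).symm
  have e2 := h.integral_snd (F := fun y => g y * Q y) (hgm.mul hQc.measurable)
  have hHR : ∀ a ∈ multiIndexLE n d, (L + 3) ^ (∑ i, a i) ≤ (L + 3) ^ d := fun a ha =>
    pow_le_pow_right₀ (by linarith) (mem_multiIndexLE.mp ha)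
  have hQb : ∀ y : Fin n → ℝ, (∀ i, |y i| ≤ L) → |Q y| ≤ Cs * (L + 3) ^ d := by
    intro y hy
    simp only [hQ, hc, hCs, Finset.sum_mul]
    refine (Finset.abs_sum_le_sum_abs _ _).trans (Finset.sum_le_sum fun a ha => ?_)
    rw [abs_mul]
    refine mul_le_mul_of_nonneg_left ?_ (abs_nonneg _)
    exact (abs_hermiteProd_le a fun i _ => hy i).trans
      ((pow_le_pow_left₀ (by linarith) (by linarith) _).trans (hHR a ha))
  have hQd : ∀ x y : Fin n → ℝ, (∀ i, |y i| ≤ L) → (∀ i, |x i - y i| ≤ δ) →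
      |Q x - Q y| ≤ Cs * (L + 3) ^ d * (δ * d) := by
    intro x y hy hxy
    simp only [hQ, hc, hCs, Finset.sum_mul, ← Finset.sum_sub_distrib]
    refine (Finset.abs_sum_le_sum_abs _ _).trans (Finset.sum_le_sum fun a ha => ?_)
    rw [← mul_sub, abs_mul, mul_assoc]
    refine mul_le_mul_of_nonneg_left ?_ (abs_nonneg _)
    have hx : ∀ i, |x i| ≤ L + 1 := fun i => by
      have := abs_sub_abs_le_abs_sub (x i) (y i)
      have := hy i; have := hxy i; linarith
    -- The Gaussian point may exceed `L` by `δ ≤ 1`; with radius `L + 1` the base becomes `L + 3`.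
    have h1 := abs_hermiteProd_sub_le a (R := L + 1) (by linarith) hδ0 (fun i _ => hx i)
      (fun i _ => (hy i).trans (by linarith)) (fun i _ => hxy i)
    have h2 : ((∑ i, a i : ℕ) : ℝ) ≤ d := by exact_mod_cast mem_multiIndexLE.mp ha
    have h3 := hHR a ha
    calc _ ≤ δ * (∑ i, a i : ℕ) * (L + 1 + 2) ^ (∑ i, a i) := h1
      _ = δ * (∑ i, a i : ℕ) * (L + 3) ^ (∑ i, a i) := by rw [show L + 1 + 2 = L + 3 by ring]
      _ ≤ δ * d * (L + 3) ^ d := by gcongr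
      _ = _ := by ring
  set Bd := {p : (Fin n → ℝ) × (Fin n → ℝ) | ∃ i, δ < |p.1 i - p.2 i|} with hBd
  have hBdm : MeasurableSet Bd := measurableSet_far δ
  set Nr : ℝ → Set ((Fin n → ℝ) × (Fin n → ℝ)) :=
    fun e => {p | |σ (WithLp.toLp 2 p.1) - e| ≤ η₀} with hNr
  have hNrm : ∀ e, MeasurableSet (Nr e) := fun e =>
    measurable_fst (measurableSet_near T.continuous e η₀)
  set W := Cs * (L + 3) ^ d with hW
  have hW0 : 0 ≤ W := by positivity
  have i1 : Integrable (fun p : (Fin n → ℝ) × (Fin n → ℝ) => g p.1 * Q p.1) ρ := by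
    refine hQi.mono ((hgm.comp measurable_fst).mul
      (hQc.measurable.comp measurable_fst)).aestronglyMeasurable (ae_of_all _ fun p => ?_)
    rw [norm_mul]
    calc _ ≤ 1 * ‖Q p.1‖ := mul_le_mul_of_nonneg_right (T.abs_le_one _) (norm_nonneg _)
      _ = _ := one_mul _
  have i2 : Integrable (fun p : (Fin n → ℝ) × (Fin n → ℝ) => g p.2 * Q p.2) ρ := by
    refine Integrable.of_bound ((hgm.comp measurable_snd).mul
      (hQc.measurable.comp measurable_snd)).aestronglyMeasurable W ?_
    filter_upwards [h.bounded] with p hp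
    rw [norm_mul]
    calc _ ≤ 1 * W := mul_le_mul (T.abs_le_one _) (hQb _ hp) (abs_nonneg _) zero_le_one
      _ = _ := one_mul _
  have j1 : Integrable (Bd.indicator fun p => |Q p.1|) ρ := hQi.abs.indicator hBdm
  have j2 : Integrable (Bd.indicator fun _ => W) ρ := (integrable_const W).indicator hBdm
  have j3 : ∀ e ∈ E, Integrable ((Nr e).indicator fun p => |Q p.1|) ρ :=
    fun e _ => hQi.abs.indicator (hNrm e)
  have j4 : Integrable (fun _ : (Fin n → ℝ) × (Fin n → ℝ) => W * (δ * d)) ρ := integrable_const _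
  have hpt : ∀ᵐ p ∂ρ, ‖g p.1 * Q p.1 - g p.2 * Q p.2‖ ≤
      W * (δ * d) + Bd.indicator (fun _ => W) p + Bd.indicator (fun p => |Q p.1|) p +
        ∑ e ∈ E, (Nr e).indicator (fun p => |Q p.1|) p := by
    filter_upwards [h.bounded] with p hp
    rw [Real.norm_eq_abs]
    have hs0 : ∀ e ∈ E, 0 ≤ (Nr e).indicator (fun p => |Q p.1|) p :=
      fun e _ => Set.indicator_nonneg (fun _ _ => abs_nonneg _) _
    by_cases hb : p ∈ Bd
    · rw [Set.indicator_of_mem hb, Set.indicator_of_mem hb]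
      have hs := Finset.sum_nonneg hs0
      have a1 : |g p.1 * Q p.1| ≤ |Q p.1| := by
        rw [abs_mul]; exact mul_le_of_le_one_left (abs_nonneg _) (T.abs_le_one _)
      have a2 : |g p.2 * Q p.2| ≤ W := by
        rw [abs_mul]
        exact (mul_le_of_le_one_left (abs_nonneg _) (T.abs_le_one _)).trans (hQb _ hp)
      have a3 : 0 ≤ W * (δ * d) := by positivity
      exact (abs_sub _ _).trans (by linarith)
    · rw [Set.indicator_of_notMem hb, Set.indicator_of_notMem hb, add_zero, add_zero]
      have hb' : ∀ i, |p.1 i - p.2 i| ≤ δ := by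
        intro i; by_contra! hi; exact hb ⟨i, hi⟩
      have a1 := T.abs_sub_le_sum_near (T.scale_sub_le_of_coord hL hδ0 hδ hb' hp)
      have a2 := hQd _ _ hp hb'
      -- The change of `g` is paired with `q(X)`, whose `L²` norm is exactly `gaussL2 q`.
      have a3 : g p.1 * Q p.1 - g p.2 * Q p.2 =
          g p.2 * (Q p.1 - Q p.2) + (g p.1 - g p.2) * Q p.1 := by ring
      rw [a3]
      refine (abs_add_le _ _).trans (add_le_add ?_ ?_)
      · rw [abs_mul]
        exact (mul_le_of_le_one_left (abs_nonneg _) (T.abs_le_one _)).trans a2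
      · rw [abs_mul]
        refine (mul_le_mul_of_nonneg_right a1 (abs_nonneg _)).trans (le_of_eq ?_)
        rw [Finset.sum_mul]
        refine Finset.sum_congr rfl fun e _ => ?_
        by_cases he : |σ (WithLp.toLp 2 p.1) - e| ≤ η₀
        · rw [Set.indicator_of_mem (show p ∈ Nr e from he), if_pos he, one_mul]
        · rw [Set.indicator_of_notMem (show p ∉ Nr e from he), if_neg he, zero_mul]
  have hfar : √(ρ.real Bd) ≤ √(n * δ) := Real.sqrt_le_sqrt h.far_le
  have hG0 : 0 ≤ gaussL2 q := Real.sqrt_nonneg _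
  have hA : ∫ p, Bd.indicator (fun p => |Q p.1|) p ∂ρ ≤ √(n * δ) * gaussL2 q := by
    refine (integral_indicator_abs_le_sqrt hQ2 hBdm).trans ?_
    rw [hQn]
    exact mul_le_mul_of_nonneg_right hfar hG0
  have hB : ∀ e ∈ E, ∫ p, (Nr e).indicator (fun p => |Q p.1|) p ∂ρ ≤
      √(10 * √η₀) * gaussL2 q := by
    intro e he
    refine (integral_indicator_abs_le_sqrt hQ2 (hNrm e)).trans ?_
    rw [hQn]
    exact mul_le_mul_of_nonneg_right (Real.sqrt_le_sqrt (h.near_fst_le T he hη₀')) hG0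
  have hC : ∫ p, Bd.indicator (fun _ => W) p ∂ρ ≤ n * δ * W := by
    rw [integral_indicator_const _ hBdm, smul_eq_mul]
    exact mul_le_mul_of_nonneg_right h.far_le hW0
  rw [e1, ← e2, ← integral_sub i1 i2, ← Real.norm_eq_abs]
  have j5 : Integrable (fun p => ∑ e ∈ E, (Nr e).indicator (fun p => |Q p.1|) p) ρ :=
    integrable_finsetSum _ j3
  refine (norm_integral_le_of_norm_le (((j4.add j2).add j1).add j5) hpt).trans ?_
  have hint : ∫ p, (((fun _ : (Fin n → ℝ) × (Fin n → ℝ) => W * (δ * d)) +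
      Bd.indicator (fun _ => W) + Bd.indicator (fun p => |Q p.1|)) +
      fun p => ∑ e ∈ E, (Nr e).indicator (fun p => |Q p.1|) p) p ∂ρ =
      W * (δ * d) + ∫ p, Bd.indicator (fun _ => W) p ∂ρ +
        ∫ p, Bd.indicator (fun p => |Q p.1|) p ∂ρ +
        ∑ e ∈ E, ∫ p, (Nr e).indicator (fun p => |Q p.1|) p ∂ρ := by
    rw [integral_add' ((j4.add j2).add j1) j5, integral_add' (j4.add j2) j1, integral_add' j4 j2,
      integral_finsetSum _ j3]
    simp
  refine (le_of_eq hint).trans ?_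
  have hsum : ∑ e ∈ E, ∫ p, (Nr e).indicator (fun p => |Q p.1|) p ∂ρ ≤
      2 * (√(10 * √η₀) * gaussL2 q) := by
    refine (Finset.sum_le_sum hB).trans ?_
    rw [Finset.sum_const, nsmul_eq_mul]
    have : (E.card : ℝ) ≤ 2 := by exact_mod_cast T.card_le
    gcongr
  linarith

/-! ### Comparison of the independent blocks with the generator -/

theorem ThresholdFn.card_forms_le {n m : ℕ} {g : (Fin n → ℝ) → ℝ}
    {w : Fin m → EuclideanSpace ℝ (Fin n)} {σ : EuclideanSpace ℝ (Fin n) → ℝ} {E : Finset ℝ}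
    (T : ThresholdFn g w σ E) : m ≤ n := by
  have := T.orthonormal.linearIndependent.fintype_card_le_finrank
  simpa using this

theorem Orthonormal.norm_sum_smul {ι F : Type*} [Fintype ι] [NormedAddCommGroup F]
    [InnerProductSpace ℝ F] {w : ι → F} (hw : Orthonormal ℝ w) (t : ι → ℝ) :
    ‖∑ j, t j • w j‖ = √(∑ j, t j ^ 2) := by
  rw [@norm_eq_sqrt_real_inner, hw.inner_sum]
  simp [sq]

theorem abs_coord_le_one_of_norm_eq_one {n : ℕ} {w : EuclideanSpace ℝ (Fin n)} (hw : ‖w‖ = 1)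
    (i : Fin n) : |w i| ≤ 1 := by
  rw [← hw, ← Real.norm_eq_abs]
  exact PiLp.norm_apply_le w i

theorem card_support_le_sum {n : ℕ} (a : Fin n → ℕ) :
    Fintype.card {i // a i ≠ 0} ≤ ∑ i, a i := by
  rw [Fintype.card_subtype, Finset.card_eq_sum_ones, Finset.sum_filter]
  refine Finset.sum_le_sum fun i _ => ?_
  split_ifs with h
  · omega
  · omega

/-- If the coordinates of a point along the forms `w` and its coordinates in the support of `a` are
known approximately, then the product `g · hermiteProd a` is known up to boundary events. -/
theorem ThresholdFn.abs_mul_hermiteProd_sub_le {n m d : ℕ} {g : (Fin n → ℝ) → ℝ}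
    {w : Fin m → EuclideanSpace ℝ (Fin n)} {σ : EuclideanSpace ℝ (Fin n) → ℝ} {E : Finset ℝ}
    (T : ThresholdFn g w σ E) {δ L : ℝ} (hL : 0 ≤ L) (hδ0 : 0 ≤ δ) (hδ : δ ≤ 1)
    {a : Fin n → ℕ} (ha : ∑ i, a i ≤ d) {y y' : Fin n → ℝ} (hy : ∀ i, |y i| ≤ L) {t : Fin m → ℝ}
    (ht : ∀ j, |t j - inner ℝ (w j) (WithLp.toLp 2 y)| ≤ δ)
    (hy' : ∀ i, a i ≠ 0 → |y' i - y i| ≤ δ) :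
    |σ (∑ j, t j • w j) - σ (WithLp.toLp 2 y)| ≤ n * δ * (2 * L + 2) ∧
    |g (∑ j, t j • w j).ofLp * hermiteProd a y'| ≤ (L + 3) ^ d ∧
    |g y * hermiteProd a y - g (∑ j, t j • w j).ofLp * hermiteProd a y'| ≤ (L + 3) ^ d *
      (δ * d + ∑ e ∈ E, if |σ (∑ j, t j • w j) - e| ≤ n * δ * (2 * L + 2) then (1 : ℝ) else 0) := by
  set z := ∑ j, t j • w j with hz
  set Y : EuclideanSpace ℝ (Fin n) := WithLp.toLp 2 y with hY
  have hσ : |σ z - σ Y| ≤ n * δ * (2 * L + 2) := by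
    -- Both points now lie in the span of `w`, with coordinates differing by at most `δ`; their
    -- distance is at most `√m δ ≤ √n δ`.
    rw [← T.proj_scale Y]
    refine T.scale_sub_le hδ0 hδ ?_ ?_
    · rw [hz, ← Finset.sum_sub_distrib]
      simp_rw [← sub_smul]
      rw [T.orthonormal.norm_sum_smul, ← Real.sqrt_sq hδ0, ← Real.sqrt_mul (by positivity)]
      refine Real.sqrt_le_sqrt ?_
      calc ∑ j, (t j - inner ℝ (w j) Y) ^ 2 ≤ ∑ _j : Fin m, δ ^ 2 := by
            refine Finset.sum_le_sum fun j _ => ?_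
            rw [← sq_abs]
            exact pow_le_pow_left₀ (abs_nonneg _) (ht j) 2
        _ = m * δ ^ 2 := by simp
        _ ≤ n * δ ^ 2 := by
            have : (m : ℝ) ≤ n := by exact_mod_cast T.card_forms_le
            gcongr
    · refine le_trans ?_ (EuclideanSpace.norm_le_sqrt_mul (x := Y) hL hy)
      rw [T.orthonormal.norm_sum_smul, ← Real.sqrt_sq (norm_nonneg Y)]
      refine Real.sqrt_le_sqrt ?_
      have := T.orthonormal.sum_inner_products_le (s := Finset.univ) Y
      simpa [Real.norm_eq_abs, sq_abs] using this
  have hpow : (L + 3) ^ (∑ i, a i) ≤ (L + 3) ^ d := pow_le_pow_right₀ (by linarith) ha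
  have hyb : ∀ i, a i ≠ 0 → |y' i| ≤ L + 1 := fun i hi => by
    have := abs_sub_abs_le_abs_sub (y' i) (y i)
    have := hy i; have := hy' i hi; linarith
  have hH' : |hermiteProd a y'| ≤ (L + 3) ^ d :=
    (abs_hermiteProd_le a hyb).trans
      ((pow_le_pow_left₀ (by linarith) (by linarith) _).trans hpow)
  have hHd : |hermiteProd a y - hermiteProd a y'| ≤ (L + 3) ^ d * (δ * d) := by
    have h1 := abs_hermiteProd_sub_le a (R := L + 1) (by linarith) hδ0
      (fun i _ => (hy i).trans (by linarith)) hyb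
      (fun i hi => by rw [abs_sub_comm]; exact hy' i hi)
    have h2 : ((∑ i, a i : ℕ) : ℝ) ≤ d := by exact_mod_cast ha
    calc _ ≤ δ * (∑ i, a i : ℕ) * (L + 1 + 2) ^ (∑ i, a i) := h1
      _ = δ * (∑ i, a i : ℕ) * (L + 3) ^ (∑ i, a i) := by rw [show L + 1 + 2 = L + 3 by ring]
      _ ≤ δ * d * (L + 3) ^ d := by gcongr
      _ = _ := by ring
  refine ⟨hσ, ?_, ?_⟩
  · rw [abs_mul]
    exact (mul_le_of_le_one_left (abs_nonneg _) (T.abs_le_one _)).trans hH'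
  · have e : g y * hermiteProd a y - g z.ofLp * hermiteProd a y' =
        g y * (hermiteProd a y - hermiteProd a y') - (g z.ofLp - g y) * hermiteProd a y' := by ring
    rw [e, mul_add]
    refine (abs_sub _ _).trans (add_le_add ?_ ?_)
    · rw [abs_mul]
      exact (mul_le_of_le_one_left (abs_nonneg _) (T.abs_le_one _)).trans hHd
    · rw [abs_mul, mul_comm]
      exact mul_le_mul hH' (T.abs_sub_le_sum_near hσ) (abs_nonneg _) (by positivity)

theorem abs_expect_sub_le_mul {α : Type*} [Fintype α] {u v N : α → ℝ} {A p b : ℝ} (hA : 0 ≤ A)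
    (hb : 0 ≤ b) (h : ∀ x, |u x - v x| ≤ A * (b + N x)) (hN : (𝔼 x, N x) ≤ p) :
    |(𝔼 x, u x) - 𝔼 x, v x| ≤ A * (b + p) := by
  rw [← Finset.expect_sub_distrib]
  refine (Finset.abs_expect_le _ _).trans ((Finset.expect_le_expect fun x _ => h x).trans ?_)
  rw [← Finset.mul_expect, Finset.expect_add_distrib]
  refine mul_le_mul_of_nonneg_left (add_le_add ?_ hN) hA
  rcases isEmpty_or_nonempty α with h | h
  · simpa using hb
  · rw [Finset.expect_const Finset.univ_nonempty]

theorem abs_sub_le_of_three {x x' y y' V W : ℝ} (h₁ : |x - y| ≤ W) (h₂ : |x' - y'| ≤ W)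
    (h : |y - y'| ≤ V) : |x - x'| ≤ V + 2 * W := by
  rw [abs_le] at *
  constructor <;> linarith [h.1, h.2, h₁.1, h₁.2, h₂.1, h₂.2]

/-- Both expectations are compared with those of a function of the rounded forms, which is fooled.
In `10 * ε`, this comparison costs `2ε`; the other `8ε` come from the boundary probabilities, each
bounded with an extra `2ε` for two levels and two sides. -/
theorem BlockCoupling.abs_expect_hermiteProd_sub_le {M S D n m d : ℕ}
    {φ : Fin n → (Fin D → Bool) → ℝ} {δ L ε : ℝ} {ρ : Measure ((Fin n → ℝ) × (Fin n → ℝ))}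
    (h : BlockCoupling φ δ L ρ) {g : (Fin n → ℝ) → ℝ} {w : Fin m → EuclideanSpace ℝ (Fin n)}
    {σ : EuclideanSpace ℝ (Fin n) → ℝ} {E : Finset ℝ} (T : ThresholdFn g w σ E) (hL : 0 ≤ L)
    (hδ0 : 0 < δ) (hδ : δ ≤ 1) (hn : 0 < n) {G : (Fin S → Bool) → Fin n → Fin D → Bool}
    (hG : FoolsROBP M ε G) (hφ : ∀ i u, |φ i u| ≤ L) {N : ℕ}
    (hN : 2 * (n * (L / (δ / n) + 1)) < N) (hNM : N ^ (m + d) ≤ 2 ^ M) {a : Fin n → ℕ}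
    (ha : ∑ i, a i ≤ d) :
    |(𝔼 x : Fin n → Fin D → Bool, g (fun i => φ i (x i)) * hermiteProd a (fun i => φ i (x i))) -
      (𝔼 z : Fin S → Bool, g (seededFamily φ G z) * hermiteProd a (seededFamily φ G z))| ≤
      (L + 3) ^ d * (10 * ε + 2 * (δ * d) + 4 * (10 * √(3 * (n * δ * (2 * L + 2))) + n * δ)) := by
  have hn' : (0 : ℝ) < n := by exact_mod_cast hn
  have hN0 : 0 < N := by
    have : (0 : ℝ) < N := lt_of_le_of_lt (by positivity) hN
    exact_mod_cast this
  have hε : 0 ≤ ε := (abs_nonneg _).trans (hG ⟨fun _ => false, fun _ m _ => m, fun _ => false⟩)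
  set η := n * δ * (2 * L + 2) with hη
  have hη0 : 0 ≤ η := by positivity
  -- The quantities to be tracked: the forms behind `g` and the at most `d` coordinates that the
  -- Hermite product reads.
  let v : Fin m ⊕ {i // a i ≠ 0} → Fin n → ℝ :=
    Sum.elim (fun j => (w j).ofLp) (fun i => Pi.single i.1 1)
  have hv : ∀ j i, |v j i| ≤ 1 := by
    rintro (j | i₀) i
    · exact abs_coord_le_one_of_norm_eq_one (T.orthonormal.1 j) i
    · by_cases hi : i = i₀.1
      · subst hi; simp [v]
      · simp [v, hi]
  have hcard : N ^ Fintype.card (Fin m ⊕ {i // a i ≠ 0}) ≤ 2 ^ M := by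
    refine le_trans (Nat.pow_le_pow_right hN0 ?_) hNM
    rw [Fintype.card_sum, Fintype.card_fin]
    exact Nat.add_le_add_left ((card_support_le_sum a).trans ha) _
  obtain ⟨ap, hap, hF⟩ := exists_fooled_approx_linear_forms hG hφ hv (div_pos hδ0 hn') hN hcard
  have hnτ : (n : ℝ) * (δ / n) = δ := by field_simp
  rw [hnτ] at hap
  let Z : (Fin m ⊕ {i // a i ≠ 0} → ℝ) → EuclideanSpace ℝ (Fin n) :=
    fun t => ∑ j, t (Sum.inl j) • w j
  let y' : (Fin m ⊕ {i // a i ≠ 0} → ℝ) → Fin n → ℝ :=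
    -- Off the support of `a` the value is irrelevant, because `hermiteN 0` is constant.
    fun t i => if hi : a i ≠ 0 then t (Sum.inr ⟨i, hi⟩) else 0
  have hmain := fun x : Fin n → Fin D → Bool =>
    T.abs_mul_hermiteProd_sub_le (d := d) hL hδ0.le hδ ha (y := fun i => φ i (x i))
      (y' := y' (ap x)) (t := fun j => ap x (Sum.inl j)) (fun i => hφ i (x i))
      (fun j => by
        have := hap x (Sum.inl j)
        simpa [v, PiLp.inner_apply, mul_comm] using this)
      (fun i hi => by
        have := hap x (Sum.inr ⟨i, hi⟩)
        simpa [v, y', hi, Pi.single_apply] using this)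
  have hnear : ∀ e ∈ E, (𝔼 x, if |σ (Z (ap x)) - e| ≤ η then (1 : ℝ) else 0) ≤
      10 * √(3 * η) + n * δ := by
    intro e he
    -- Rounding turns the window `η` into `2η`, and the coupling inside `expect_near_le` adds
    -- another `η`.
    have h1 := h.expect_near_le T hL hδ0.le hδ he (η := 2 * η) (by positivity)
    rw [← hη, show 2 * η + η = 3 * η by ring] at h1
    refine (Finset.expect_le_expect fun x _ => ?_).trans h1
    have h2 := (hmain x).1
    by_cases h3 : |σ (Z (ap x)) - e| ≤ η
    · have h4 : |σ (WithLp.toLp 2 fun i => φ i (x i)) - e| ≤ 2 * η := by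
        have h5 := abs_sub_le (σ (WithLp.toLp 2 fun i => φ i (x i))) (σ (Z (ap x))) e
        rw [abs_sub_comm] at h2
        exact h5.trans (by linarith)
      rw [if_pos h3, if_pos h4]
    · rw [if_neg h3]; split_ifs <;> norm_num
  have hnear' : ∀ e ∈ E, (𝔼 z, if |σ (Z (ap (G z))) - e| ≤ η then (1 : ℝ) else 0) ≤
      10 * √(3 * η) + n * δ + 2 * ε := by
    intro e he
    have h1 := hF (fun t => if |σ (Z t) - e| ≤ η then (1 : ℝ) else 0) 1 (fun x => by
      split_ifs <;> simp)
    have h2 := hnear e he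
    have h3 := (abs_le.mp h1).1
    linarith
  set P := 10 * √(3 * η) + n * δ with hP
  have hP0 : 0 ≤ P := by positivity
  have hE : (E.card : ℝ) ≤ 2 := by exact_mod_cast T.card_le
  have hS : (𝔼 x, ∑ e ∈ E, if |σ (Z (ap x)) - e| ≤ η then (1 : ℝ) else 0) ≤ 2 * (P + 2 * ε) := by
    rw [Finset.expect_sum_comm]
    refine (Finset.sum_le_sum hnear).trans ?_
    rw [Finset.sum_const, nsmul_eq_mul]
    exact mul_le_mul hE (by linarith) hP0 (by norm_num)
  have hS' : (𝔼 z, ∑ e ∈ E, if |σ (Z (ap (G z))) - e| ≤ η then (1 : ℝ) else 0) ≤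
      2 * (P + 2 * ε) := by
    rw [Finset.expect_sum_comm]
    refine (Finset.sum_le_sum hnear').trans ?_
    rw [Finset.sum_const, nsmul_eq_mul]
    exact mul_le_mul_of_nonneg_right hE (by positivity)
  have hV := hF (fun t => g (Z t).ofLp * hermiteProd a (y' t)) ((L + 3) ^ d) fun x => (hmain x).2.1
  have h1 := abs_expect_sub_le_mul (by positivity : 0 ≤ (L + 3) ^ d)
    (by positivity : 0 ≤ δ * (d : ℝ)) (fun x => (hmain x).2.2) hS
  have h2 := abs_expect_sub_le_mul (by positivity : 0 ≤ (L + 3) ^ d)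
    (by positivity : 0 ≤ δ * (d : ℝ)) (fun z => (hmain (G z)).2.2) hS'
  refine (abs_sub_le_of_three h1 h2 hV).trans (le_of_eq ?_)
  ring

/-! ### The main estimate -/

/-- With `y = n/δ`, the required modulus is at most `(2K+1) y²`, so `log N ≤ (3K+2) log y`; this
fixes `C₁`. -/
theorem exists_modulus {K δ C₁ : ℝ} {n m d r M : ℕ} (hK : 0 < K) (hn : 0 < n) (hδ0 : 0 < δ)
    (hδ : δ ≤ 1 / 2) (hm : m ≤ r) (hC₁ : C₁ = (3 * K + 2) / Real.log 2)
    (hM : C₁ * ((d : ℝ) + r) * Real.log (n / δ) ≤ M) :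
    ∃ N : ℕ, 2 * (n * (K * Real.log (1 / δ) / (δ / n) + 1)) < N ∧ N ^ (m + d) ≤ 2 ^ M := by
  have hn1 : (1 : ℝ) ≤ n := by exact_mod_cast hn
  have hlog2 : 0.69 < Real.log 2 := by linarith [Real.log_two_gt_d9]
  set y : ℝ := n / δ with hy
  have hyδ : 1 / δ ≤ y := by rw [hy]; gcongr
  have hδ2 : 2 ≤ 1 / δ := by rw [le_div_iff₀ hδ0]; linarith
  have hy2 : 2 ≤ y := hδ2.trans hyδ
  have hny : (n : ℝ) ≤ y / 2 := by
    rw [hy, div_div, le_div_iff₀ (by positivity)]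
    nlinarith
  set L := K * Real.log (1 / δ) with hL
  have hlogδ : 0 ≤ Real.log (1 / δ) := Real.log_nonneg (by linarith)
  have hL0 : 0 ≤ L := by positivity
  have hnL : n * L ≤ K * y := by
    have h1 : Real.log (1 / δ) ≤ 1 / δ := (Real.log_le_sub_one_of_pos (by positivity)).trans
      (by linarith)
    calc n * L = K * (n * Real.log (1 / δ)) := by rw [hL]; ring
      _ ≤ K * (n * (1 / δ)) := by gcongr
      _ = K * y := by rw [hy]; ring
  set b : ℝ := 2 * (n * (L / (δ / n) + 1)) with hb
  have hb' : b = 2 * (n * L * y + n) := by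
    rw [hb, hy]; field_simp
  have hb0 : 0 ≤ b := by rw [hb']; positivity
  refine ⟨⌊b⌋₊ + 1, by push_cast; exact Nat.lt_floor_add_one b, ?_⟩
  set N := ⌊b⌋₊ + 1 with hN
  have hNb : (N : ℝ) ≤ (2 * K + 1) * y ^ 2 := by
    have h1 : (⌊b⌋₊ : ℝ) ≤ b := Nat.floor_le hb0
    have h2 : n * L * y ≤ K * y * y := by gcongr
    push_cast [hN]
    nlinarith
  have hN1 : 1 ≤ N := by omega
  have hN1' : (0 : ℝ) < N := by exact_mod_cast hN1
  have hlogy : Real.log 2 ≤ Real.log y := Real.log_le_log (by norm_num) hy2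
  have hlogN : Real.log N ≤ (3 * K + 2) * Real.log y := by
    calc Real.log N ≤ Real.log ((2 * K + 1) * y ^ 2) := Real.log_le_log hN1' hNb
      _ = Real.log (2 * K + 1) + 2 * Real.log y := by
        rw [Real.log_mul (by positivity) (by positivity), Real.log_pow]; push_cast; ring
      _ ≤ 2 * K + 2 * Real.log y := by
        have := Real.log_le_sub_one_of_pos (show 0 < 2 * K + 1 by positivity)
        linarith
      -- Here `2K ≤ 3K log 2 ≤ 3K log y`.
      _ ≤ _ := by nlinarith
  refine (Nat.pow_le_pow_right hN1 (Nat.add_le_add_right hm d)).trans ?_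
  have hfin : Real.log ((N : ℝ) ^ (r + d)) ≤ Real.log ((2 : ℝ) ^ M) := by
    rw [Real.log_pow, Real.log_pow]
    have h1 : C₁ * Real.log 2 = 3 * K + 2 := by
      rw [hC₁]; exact div_mul_cancel₀ _ (by linarith)
    calc ((r + d : ℕ) : ℝ) * Real.log N ≤ ((r + d : ℕ) : ℝ) * ((3 * K + 2) * Real.log y) := by gcongr
      _ = (C₁ * ((d : ℝ) + r) * Real.log y) * Real.log 2 := by rw [← h1]; push_cast; ring
      _ ≤ M * Real.log 2 := by gcongr
  have h2 := (Real.log_le_log_iff (by positivity) (by positivity)).mp hfin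
  exact_mod_cast h2

/-- The arithmetic that collects all error terms. -/
theorem collect_error_terms {n d : ℕ} (hn : 0 < n) {L δ ε Cs q₂ : ℝ} (hL : 0 ≤ L) (hδ0 : 0 < δ)
    (hδ : δ ≤ 1) (hε : 0 ≤ ε) (hq : 0 ≤ q₂) (hCs : Cs ≤ (n + 1) ^ d * q₂) :
    (Cs * (L + 3) ^ d * (δ * d + n * δ) + √(n * δ) * q₂ +
        2 * (√(10 * √(n * δ * (2 * L + 2))) * q₂)) +
      Cs * ((L + 3) ^ d *
        (10 * ε + 2 * (δ * d) + 4 * (10 * √(3 * (n * δ * (2 * L + 2))) + n * δ))) ≤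
      (131 * (L + 3)) ^ (d + 1) * (ε + n * δ ^ (1 / 4 : ℝ)) * n ^ d * q₂ := by
  have hn1 : (1 : ℝ) ≤ n := by exact_mod_cast hn
  set u := δ ^ (1 / 4 : ℝ) with hu
  have hu0 : 0 < u := Real.rpow_pos_of_pos hδ0 _
  have hu1 : u ≤ 1 := Real.rpow_le_one hδ0.le hδ (by norm_num)
  have hu4 : δ = u ^ 4 := by
    rw [hu, ← Real.rpow_natCast, ← Real.rpow_mul hδ0.le]; norm_num
  set R := L + 3 with hR
  have hR3 : 3 ≤ R := by linarith
  set t := n * u with ht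
  have ht0 : 0 < t := by positivity
  have hδu : δ ≤ u := by
    rw [hu4]; calc u ^ 4 ≤ u ^ 1 := pow_le_pow_of_le_one hu0.le hu1 (by norm_num)
      _ = u := pow_one u
  have hδu2 : δ ≤ u ^ 2 := by
    rw [hu4]; exact pow_le_pow_of_le_one hu0.le hu1 (by norm_num)
  have b1 : n * δ ≤ t := by rw [ht]; gcongr
  have b0 : δ ≤ t := by
    calc δ ≤ u := hδu
      _ ≤ n * u := le_mul_of_one_le_left hu0.le hn1
  have hnn : (n : ℝ) ≤ (n : ℝ) ^ 2 := by nlinarith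
  have hnt : n * δ ≤ t ^ 2 := by
    calc n * δ ≤ (n : ℝ) ^ 2 * u ^ 2 := by gcongr
      _ = t ^ 2 := by rw [ht]; ring
  have b2 : √(n * δ) ≤ t := Real.sqrt_le_iff.mpr ⟨ht0.le, hnt⟩
  have hη : n * δ * (2 * L + 2) ≤ n * δ * (2 * R) := by gcongr; linarith
  have b3 : √(3 * (n * δ * (2 * L + 2))) ≤ 3 * R * t := by
    refine Real.sqrt_le_iff.mpr ⟨by positivity, ?_⟩
    calc 3 * (n * δ * (2 * L + 2)) ≤ 3 * (n * δ * (2 * R)) := by gcongr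
      _ ≤ 3 * (t ^ 2 * (2 * R)) := by gcongr
      _ = t ^ 2 * (6 * R) := by ring
      _ ≤ t ^ 2 * (9 * R ^ 2) := mul_le_mul_of_nonneg_left (by nlinarith) (by positivity)
      _ = (3 * R * t) ^ 2 := by ring
  -- The one term that needs the full fourth root of `δ`; the other terms have room to spare.
  have b4 : √(10 * √(n * δ * (2 * L + 2))) ≤ 4 * R * t := by
    have h1 : √(n * δ * (2 * L + 2)) ≤ R ^ 2 * t ^ 2 := by
      refine Real.sqrt_le_iff.mpr ⟨by positivity, ?_⟩
      have h2 : n * δ ≤ t ^ 4 := by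
        have : (n : ℝ) ≤ (n : ℝ) ^ 4 := le_self_pow₀ hn1 (by norm_num)
        calc n * δ ≤ (n : ℝ) ^ 4 * u ^ 4 := by rw [← hu4]; gcongr
          _ = t ^ 4 := by rw [ht]; ring
      have h3 : 2 * R ≤ R ^ 4 := by
        have h5 : R ^ 2 ≤ R ^ 4 := pow_le_pow_right₀ (by linarith) (by norm_num)
        nlinarith
      calc n * δ * (2 * L + 2) ≤ n * δ * (2 * R) := hη
        _ ≤ t ^ 4 * R ^ 4 := by gcongr
        _ = (R ^ 2 * t ^ 2) ^ 2 := by ring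
    refine Real.sqrt_le_iff.mpr ⟨by positivity, ?_⟩
    nlinarith [sq_nonneg (R * t)]
  -- The factor `d` is absorbed in `2^d`; a second `2^d` comes from `n + 1 ≤ 2n`, and together they
  -- give `(4R)^d`.
  have hd2 : (d : ℝ) ≤ 2 ^ d := by exact_mod_cast (Nat.lt_two_pow_self).le
  have h2d : (1 : ℝ) ≤ 2 ^ d := one_le_pow₀ (by norm_num)
  set P := (2 * R) ^ d with hP
  have hP1 : 1 ≤ P := one_le_pow₀ (by linarith)
  set A := (n : ℝ) ^ d with hA
  have hA1 : 1 ≤ A := one_le_pow₀ hn1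
  have hCsR : Cs * R ^ d ≤ A * P * q₂ := by
    calc Cs * R ^ d ≤ ((n + 1) ^ d * q₂) * R ^ d := by gcongr
      _ ≤ ((2 * n) ^ d * q₂) * R ^ d := by gcongr; linarith
      _ = _ := by rw [hA, hP, mul_pow, mul_pow]; ring
  have hX0 : 0 ≤ 10 * ε + 3 * (δ * d) + 5 * (n * δ) + 40 * √(3 * (n * δ * (2 * L + 2))) := by
    positivity
  have hX : 10 * ε + 3 * (δ * d) + 5 * (n * δ) + 40 * √(3 * (n * δ * (2 * L + 2))) ≤
      2 ^ d * (10 * ε + (8 + 120 * R) * t) := by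
    have h1 : δ * d ≤ t * 2 ^ d := by gcongr
    have h2 : 10 * ε + (5 + 120 * R) * t ≤ 2 ^ d * (10 * ε + (5 + 120 * R) * t) :=
      le_mul_of_one_le_left (by positivity) h2d
    linarith
  have hAP : q₂ ≤ A * P * 2 ^ d * q₂ := by
    refine le_mul_of_one_le_left hq ?_
    exact one_le_mul_of_one_le_of_one_le (one_le_mul_of_one_le_of_one_le hA1 hP1) h2d
  have e : (Cs * R ^ d * (δ * d + n * δ) + √(n * δ) * q₂ +
        2 * (√(10 * √(n * δ * (2 * L + 2))) * q₂)) +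
      Cs * (R ^ d * (10 * ε + 2 * (δ * d) + 4 * (10 * √(3 * (n * δ * (2 * L + 2))) + n * δ))) =
      Cs * R ^ d * (10 * ε + 3 * (δ * d) + 5 * (n * δ) + 40 * √(3 * (n * δ * (2 * L + 2)))) +
        (√(n * δ) + 2 * √(10 * √(n * δ * (2 * L + 2)))) * q₂ := by ring
  rw [e]
  calc _ ≤ A * P * q₂ * (2 ^ d * (10 * ε + (8 + 120 * R) * t)) +
        (t + 2 * (4 * R * t)) * (A * P * 2 ^ d * q₂) := by gcongr
    _ = A * P * 2 ^ d * q₂ * (10 * ε + (9 + 128 * R) * t) := by ring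
    -- Since `R ≥ 3`, `9 + 128R ≤ 131R`.
    _ ≤ A * P * 2 ^ d * q₂ * (131 * R * ε + 131 * R * t) := by
        gcongr <;> linarith
    _ = ((4 * R) ^ d * (131 * R)) * (ε + t) * A * q₂ := by
        rw [hP, show (4 : ℝ) * R = 2 * R * 2 by ring, mul_pow (2 * R) 2]; ring
    _ ≤ ((131 * R) ^ d * (131 * R)) * (ε + t) * A * q₂ := by gcongr; norm_num
    _ = _ := by rw [pow_succ]

theorem abs_gaussian_sub_generator_le {K : ℝ} (hK : 0 < K) {n d M S D r : ℕ} {δ ε : ℝ}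
    (hn : 0 < n) (hδ0 : 0 < δ) (hδ : δ ≤ 1 / 2) {φ : Fin n → (Fin D → Bool) → ℝ}
    {G : (Fin S → Bool) → Fin n → Fin D → Bool}
    (hφ : ∀ i, IsApproxGaussian K δ (blockLaw (φ i))) (hG : FoolsROBP M ε G)
    {q : MvPolynomial (Fin n) ℝ} (hq : q.totalDegree ≤ d) {s : MvPolynomial (Fin n) ℝ} {I : Set ℝ}
    (hs : s.totalDegree ≤ 2) (hr : DependsOnLinear r s) (hI : I.OrdConnected)
    (hM : (3 * K + 2) / Real.log 2 * ((d : ℝ) + r) * Real.log (n / δ) ≤ M) :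
    |(∫ x, indIn s I x * MvPolynomial.eval x q ∂(stdGauss n)) -
      (𝔼 z : Fin S → Bool, indIn s I (seededFamily φ G z) *
        MvPolynomial.eval (seededFamily φ G z) q)| ≤
      (131 * (K + 5) * Real.log (1 / δ)) ^ (d + 1) * (ε + n * δ ^ (1 / 4 : ℝ)) * n ^ d *
        gaussL2 q := by
  obtain ⟨m, hm, w, σ, E, T⟩ := exists_thresholdFn s hs hr hI
  obtain ⟨ρ, hρ⟩ := exists_blockCoupling hδ0.le hφ
  obtain ⟨c, hc⟩ := eval_eq_sum_hermiteProd q hq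
  obtain ⟨N, hN, hNM⟩ := exists_modulus hK hn hδ0 hδ hm rfl hM
  have hlog : 0.69 ≤ Real.log (1 / δ) := by
    have h1 : Real.log 2 ≤ Real.log (1 / δ) :=
      Real.log_le_log (by norm_num) (by rw [le_div_iff₀ hδ0]; linarith)
    linarith [Real.log_two_gt_d9]
  set L := K * Real.log (1 / δ) with hL
  have hL0 : 0 ≤ L := by positivity
  have hφL : ∀ i u, |φ i u| ≤ L := fun i u => abs_le_of_ae_blockLaw (hφ i).2 u
  have hε : 0 ≤ ε := (abs_nonneg _).trans (hG ⟨fun _ => false, fun _ m _ => m, fun _ => false⟩)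
  have hq0 : 0 ≤ gaussL2 q := Real.sqrt_nonneg _
  have hδ1 : δ ≤ 1 := by linarith
  set g := indIn s I with hg
  have h1 := hρ.abs_integral_sub_expect_le T hL0 hδ0.le hδ1 q hc
  have h2 : |(𝔼 x : Fin n → Fin D → Bool, g (fun i => φ i (x i)) *
        MvPolynomial.eval (fun i => φ i (x i)) q) -
      (𝔼 z : Fin S → Bool, g (seededFamily φ G z) *
        MvPolynomial.eval (seededFamily φ G z) q)| ≤
      (∑ a ∈ multiIndexLE n d, |c a|) * ((L + 3) ^ d *
        (10 * ε + 2 * (δ * d) + 4 * (10 * √(3 * (n * δ * (2 * L + 2))) + n * δ))) := by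
    have e : ∀ {γ : Type} [Fintype γ] (f : γ → Fin n → ℝ),
        (𝔼 x, g (f x) * MvPolynomial.eval (f x) q) =
        ∑ a ∈ multiIndexLE n d, c a * 𝔼 x, g (f x) * hermiteProd a (f x) := by
      intro γ _ f
      simp_rw [hc, Finset.mul_sum, Finset.mul_expect]
      rw [Finset.expect_sum_comm]
      exact Finset.sum_congr rfl fun a _ => Finset.expect_congr rfl fun x _ => by ring
    rw [e, e, ← Finset.sum_sub_distrib, Finset.sum_mul]
    refine (Finset.abs_sum_le_sum_abs _ _).trans (Finset.sum_le_sum fun a ha => ?_)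
    rw [← mul_sub, abs_mul]
    exact mul_le_mul_of_nonneg_left (hρ.abs_expect_hermiteProd_sub_le T hL0 hδ0 hδ1 hn hG hφL hN hNM
      (mem_multiIndexLE.mp ha)) (abs_nonneg _)
  have hCs : ∑ a ∈ multiIndexLE n d, |c a| ≤ ((n : ℝ) + 1) ^ d * gaussL2 q := by
    refine (Finset.sum_le_sum fun a ha => abs_coeff_le_gaussL2 hc ha).trans ?_
    rw [Finset.sum_const, nsmul_eq_mul]
    refine mul_le_mul_of_nonneg_right ?_ hq0
    exact_mod_cast card_multiIndexLE_le n d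
  refine (abs_sub_le _ _ _).trans ((add_le_add h1 h2).trans
    ((collect_error_terms hn hL0 hδ0 hδ1 hε hq0 hCs).trans ?_))
  -- Since `log (1/δ) ≥ 0.69`, the summand 3 is at most `5 log (1/δ)`.
  have hR : 131 * (L + 3) ≤ 131 * (K + 5) * Real.log (1 / δ) := by
    rw [hL]; linarith
  have hu : 0 ≤ δ ^ (1 / 4 : ℝ) := Real.rpow_nonneg hδ0.le _
  gcongr

theorem mainTheorem4 (K : ℝ) (hK : 0 < K) :
    ∃ C₁ C₂ : ℝ, 0 < C₁ ∧ 0 < C₂ ∧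
      ∀ (n d M S D : ℕ) (δ₁ δ₂ : ℝ), 0 < n → 0 < δ₁ → δ₁ ≤ 1 / 2 →
      ∀ (φ : Fin n → (Fin D → Bool) → ℝ) (G : (Fin S → Bool) → Fin n → Fin D → Bool),
        (∀ i, IsApproxGaussian K δ₁ (blockLaw (φ i))) →
        FoolsROBP M δ₂ G →
        ∀ q : MvPolynomial (Fin n) ℝ, q.totalDegree ≤ d →
          (∀ (r : ℕ) (s : MvPolynomial (Fin n) ℝ) (I : Set ℝ),
            s.totalDegree ≤ 2 → DependsOnLinear r s → I.OrdConnected →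
            C₁ * ((d : ℝ) + (r : ℝ)) * Real.log ((n : ℝ) / δ₁) ≤ (M : ℝ) →
            |(∫ x, indIn s I x * MvPolynomial.eval x q ∂(stdGauss n)) -
              (𝔼 z : Fin S → Bool, indIn s I (seededFamily φ G z) *
                MvPolynomial.eval (seededFamily φ G z) q)| ≤
              (C₂ * Real.log (1 / δ₁)) ^ (d + 1) * (δ₂ + (n : ℝ) * δ₁ ^ (1 / 4 : ℝ)) *
                (n : ℝ) ^ d * gaussL2 q) ∧
          (C₁ * (d : ℝ) * Real.log ((n : ℝ) / δ₁) ≤ (M : ℝ) →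
            |(∫ x, MvPolynomial.eval x q ∂(stdGauss n)) -
              (𝔼 z : Fin S → Bool, MvPolynomial.eval (seededFamily φ G z) q)| ≤
              (C₂ * Real.log (1 / δ₁)) ^ (d + 1) * (δ₂ + (n : ℝ) * δ₁ ^ (1 / 4 : ℝ)) *
                (n : ℝ) ^ d * gaussL2 q) := by
  have hlog2 : 0 < Real.log 2 := Real.log_pos (by norm_num)
  refine ⟨(3 * K + 2) / Real.log 2, 131 * (K + 5), by positivity, by positivity, ?_⟩
  intro n d M S D δ₁ δ₂ hn hδ0 hδ φ G hφ hG q hq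
  refine ⟨fun r s I hs hr hI hM =>
    abs_gaussian_sub_generator_le hK hn hδ0 hδ hφ hG hq hs hr hI hM, fun hM => ?_⟩
  -- The zero polynomial with `I = ℝ` has indicator 1 and depends on no linear form.
  have h := abs_gaussian_sub_generator_le (r := 0) (s := 0) (I := Set.univ) hK hn hδ0 hδ hφ hG hq
    (by simp) ⟨fun _ _ => 0, fun x y _ => by simp⟩ Set.ordConnected_univ (by simpa using hM)
  simpa [indIn] using h
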